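/- Let $\mathcal P$ be a countably infinite set of monadic predicate symbols, enumerated without repetition as $P_0,P_1,\dots$. The formulas of $\mathrm{FOLTL}^{\neq}$ are given by the grammar $$\varphi ::= P(x)\mid \neg\varphi\mid \varphi\wedge\psi\mid \Diamond_F\varphi\mid \exists^{\neq}x\,\varphi ,\qquad P\in\mathcal P,$$ with a single variable $x$. A constant domain model over a linear order $\langle T,<\rangle$ (with $<$ irreflexive, transitive and trichotomous) consists of a non-empty set $D$ and, for every $t\in T$ and $P\in\mathcal P$, a set $P^{I(t)}\subseteq D$. Truth of a formula at $t\in T$ under the assignment of $a\in D$ to $x$ is defined by: $t\models^a P(x)$ iff $a\in P^{I(t)}$; $\neg$ and $\wedge$ as usual; $t\models^a\Diamond_F\varphi$ iff $t'\models^a\varphi$ for some $t'\in T$ with $t<t'$; and $t\models^a\exists^{\neq}x\,\varphi$ iff $t\models^b\varphi$ for some $b\in D$ with $b\neq a$. A formula $\varphi$ is satisfiable in constant domain models over the class of all linear orders if there are a linear order $\langle T,<\rangle$, a constant domain model over it, $t\in T$ and $a\in D$ with $t\models^a\varphi$. Then the set of $\mathrm{FOLTL}^{\neq}$-formulas that are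 satisfiable in constant domain models over the class of all linear orders is undecidable, but its complement (the set of formulas that are not so satisfiable) is recursively enumerable. Here decidability and recursive enumerability refer to a standard Gödel numbering of the formulas relative to the enumeration of $\mathcal P$. -/

import Mathlib

universe u v w

namespace FOLTL

/-- Formulas of one-variable monadic first-order linear temporal logic with the "elsewhere"
quantifier, over a set `P` of monadic predicate symbols. As there is only one variable `x`,
it is left implicit. -/
inductive Formula (P : Type u) : Type u
  /-- the atomic formula `P(x)` -/
  | pred : P → Formula P
  /-- negation -/
  | neg : Formula P → Formula P
  /-- conjunction -/
  | and : Formula P → Formula P → Formula P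
  /-- "eventually" (at some strictly later moment) -/
  | diamF : Formula P → Formula P
  /-- "for some other `x`" -/
  | exNe : Formula P → Formula P

namespace Formula

variable {P : Type u} [Denumerable P]

/-- Goedel numbering of formulas, relative to a numbering of the predicate symbols. -/
def toNat : Formula P → ℕ
  | pred p => 5 * Encodable.encode p
  | neg φ => 5 * φ.toNat + 1
  | and φ ψ => 5 * Nat.pair φ.toNat ψ.toNat + 2
  | diamF φ => 5 * φ.toNat + 3
  | exNe φ => 5 * φ.toNat + 4

/-- The formula with a given Goedel number. -/
def ofNat (n : ℕ) : Formula P :=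
  if h0 : n % 5 = 0 then pred (Denumerable.ofNat P (n / 5))
  else
    have h : n / 5 < n := by omega
    have hl : (n / 5).unpair.1 < n := (Nat.unpair_left_le _).trans_lt h
    have hr : (n / 5).unpair.2 < n := (Nat.unpair_right_le _).trans_lt h
    if n % 5 = 1 then neg (ofNat (n / 5))
    else if n % 5 = 2 then and (ofNat (n / 5).unpair.1) (ofNat (n / 5).unpair.2)
    else if n % 5 = 3 then diamF (ofNat (n / 5))
    else exNe (ofNat (n / 5))
termination_by n

theorem ofNat_toNat (φ : Formula P) : ofNat φ.toNat = φ := by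
  induction φ with
  | pred p => rw [ofNat]; simp [toNat]
  | neg φ ih =>
    have h1 : (5 * φ.toNat + 1) % 5 = 1 := by omega
    have h2 : (5 * φ.toNat + 1) / 5 = φ.toNat := by omega
    rw [toNat, ofNat]; simp [h1, h2, ih]
  | and φ ψ ih1 ih2 =>
    have h1 : (5 * Nat.pair φ.toNat ψ.toNat + 2) % 5 = 2 := by omega
    have h2 : (5 * Nat.pair φ.toNat ψ.toNat + 2) / 5 = Nat.pair φ.toNat ψ.toNat := by omega
    rw [toNat, ofNat]; simp [h1, h2, ih1, ih2]
  | diamF φ ih =>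
    have h1 : (5 * φ.toNat + 3) % 5 = 3 := by omega
    have h2 : (5 * φ.toNat + 3) / 5 = φ.toNat := by omega
    rw [toNat, ofNat]; simp [h1, h2, ih]
  | exNe φ ih =>
    have h1 : (5 * φ.toNat + 4) % 5 = 4 := by omega
    have h2 : (5 * φ.toNat + 4) / 5 = φ.toNat := by omega
    rw [toNat, ofNat]; simp [h1, h2, ih]

theorem toNat_ofNat (n : ℕ) : (ofNat n : Formula P).toNat = n := by
  induction n using Nat.strong_induction_on with
  | _ n ih =>
    rw [ofNat]
    by_cases h0 : n % 5 = 0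
    · simp only [h0, dite_true, toNat, Denumerable.encode_ofNat]; omega
    · have h : n / 5 < n := by omega
      have hl : (n / 5).unpair.1 < n := (Nat.unpair_left_le _).trans_lt h
      have hr : (n / 5).unpair.2 < n := (Nat.unpair_right_le _).trans_lt h
      simp only [h0, dite_false]
      split_ifs
      · simp only [toNat, ih _ h]; omega
      · simp only [toNat, ih _ hl, ih _ hr, Nat.pair_unpair]; omega
      · simp only [toNat, ih _ h]; omega
      · simp only [toNat, ih _ h]; omega

/-- Formulas are numbered by their Goedel numbers; computability of sets of formulas refers to
this numbering. -/
instance : Denumerable (Formula P) :=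
  Denumerable.mk' ⟨toNat, ofNat, ofNat_toNat, toNat_ofNat⟩

end Formula

/-- A first-order temporal model on the timeline `T`: a non-empty domain `dom t` at each moment
`t` (a subset of an ambient set `U` of objects), and an interpretation of every predicate symbol
in `dom t` at each moment `t`. -/
structure Model (P : Type u) (T : Type v) [LinearOrder T] where
  /-- ambient set of objects -/
  U : Type w
  /-- the domain at each moment -/
  dom : T → Set U
  dom_nonempty : ∀ t, (dom t).Nonempty
  /-- the interpretation of the predicate symbols at each moment -/
  interp : T → P → Set U
  interp_subset : ∀ t p, interp t p ⊆ dom t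

namespace Model

variable {P : Type u} {T : Type v} [LinearOrder T]

/-- The truth relation; it is meant for `a ∈ M.dom t`. -/
def Holds (M : Model.{u, v, w} P T) : T → M.U → Formula P → Prop
  | t, a, .pred p => a ∈ M.interp t p
  | t, a, .neg φ => ¬ M.Holds t a φ
  | t, a, .and φ ψ => M.Holds t a φ ∧ M.Holds t a ψ
  | t, a, .diamF φ => ∃ t' : T, t < t' ∧ a ∈ M.dom t' ∧ M.Holds t' a φ
  | t, a, .exNe φ => ∃ b ∈ M.dom t, b ≠ a ∧ M.Holds t b φ

/-- `M` is a constant domain model. -/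
def IsConstantDomain (M : Model.{u, v, w} P T) : Prop :=
  ∀ t t' : T, t < t' → M.dom t = M.dom t'

/-- `φ` is satisfiable in `M`. -/
def Satisfies (M : Model.{u, v, w} P T) (φ : Formula P) : Prop :=
  ∃ t : T, ∃ a ∈ M.dom t, M.Holds t a φ

end Model

/-- `φ` is satisfiable in constant domain models over the class of all linear orders. -/
def ConstantDomainSatisfiable {P : Type u} (φ : Formula P) : Prop :=
  ∃ (T : Type v) (_ : LinearOrder T) (M : Model.{u, v, w} P T),
    M.IsConstantDomain ∧ M.Satisfies φ

end FOLTL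

/-! Enumerating the unsatisfiable formulas rests on Löwenheim–Skolem and compactness. From a
constant domain model one can extract countably many indexed moments and objects, closed under
witnesses. So satisfiability amounts to the existence of a propositional valuation of the atoms
"moment s is before t", "objects a and b are equal" and "formula n holds at t for a" that satisfies
a primitive recursive sequence of Henkin clauses
(`constantDomainSatisfiable_iff_exists_satisfiesClauses`). By compactness of Cantor space an
unsatisfiable sequence is refuted at a finite stage, which a search finds
(`rePred_not_exists_satisfiesClauses`).

Undecidability reduces non-halting of a register machine to satisfiability. The steps of a run are
events, each with an object of its own that is never used again; the elsewhere quantifier expresses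
its uniqueness. The object names its event, so "the next event" is definable over any linear order,
even a dense one. The content of a register is the number of objects inserted and not yet deleted.
An event inserts at most its own object and deletes at most one, and nothing changes otherwise.
Hence the number of live objects follows the register (`encard_live_next`), and a model forces the
run to be infinite (`not_halt_of_tr_runFormula`). Conversely, an infinite run gives a model with
moments and objects in `ℕ`, in which registers are queues (`IsRun.tr_runFormula`). The machine
executes one fixed program whose halting problem in its input is undecidable
(`Prog.exists_not_computablePred_halts`); only the loading prefix of the formula depends on the
input. -/

namespace FOLTL

/-! ### Primitive recursive predicates and propositional compactness -/

section PrimrecFunProp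

attribute [local fun_prop] Primrec
attribute [local fun_prop] Primrec.comp Primrec.id Primrec.const Primrec.fst Primrec.snd Primrec.pair

variable {α β : Type*} [Primcodable α] [Primcodable β]

@[local fun_prop]
theorem primrec_natAdd {f g : α → ℕ} (hf : Primrec f) (hg : Primrec g) :
    Primrec fun a => f a + g a :=
  Primrec.nat_add.comp hf hg

@[local fun_prop]
theorem primrec_natMul {f g : α → ℕ} (hf : Primrec f) (hg : Primrec g) :
    Primrec fun a => f a * g a :=
  Primrec.nat_mul.comp hf hg

@[local fun_prop]
theorem primrec_natDiv {f g : α → ℕ} (hf : Primrec f) (hg : Primrec g) :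
    Primrec fun a => f a / g a :=
  Primrec.nat_div.comp hf hg

@[local fun_prop]
theorem primrec_natMod {f g : α → ℕ} (hf : Primrec f) (hg : Primrec g) :
    Primrec fun a => f a % g a :=
  Primrec.nat_mod.comp hf hg

@[local fun_prop]
theorem primrec_natPow {f g : α → ℕ} (hf : Primrec f) (hg : Primrec g) :
    Primrec fun a => f a ^ g a :=
  (Primrec₂.unpaired'.1 Nat.Primrec.pow).comp hf hg

@[local fun_prop]
theorem primrec_natPair {f g : α → ℕ} (hf : Primrec f) (hg : Primrec g) :
    Primrec fun a => Nat.pair (f a) (g a) :=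
  Primrec₂.natPair.comp hf hg

@[local fun_prop]
theorem primrec_unpair_fst {f : α → ℕ} (hf : Primrec f) : Primrec fun a => (f a).unpair.1 :=
  Primrec.fst.comp (Primrec.unpair.comp hf)

@[local fun_prop]
theorem primrec_unpair_snd {f : α → ℕ} (hf : Primrec f) : Primrec fun a => (f a).unpair.2 :=
  Primrec.snd.comp (Primrec.unpair.comp hf)

@[local fun_prop]
theorem primrec_listCons {f : α → β} {g : α → List β} (hf : Primrec f) (hg : Primrec g) :
    Primrec fun a => f a :: g a :=
  Primrec.list_cons.comp hf hg

theorem primrecPred_forall_lt {p : α → ℕ → Prop} {b : α → ℕ}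
    (hp : PrimrecPred fun q : ℕ × α => p q.2 q.1) (hb : Primrec b) :
    PrimrecPred fun a => ∀ x < b a, p a x := by
  have h := (PrimrecRel.forall_mem_list (R := fun x a => p a x) hp).comp
    (Primrec.list_range.comp hb) Primrec.id
  simpa using h

theorem primrecPred_exists_lt {p : α → ℕ → Prop} {b : α → ℕ}
    (hp : PrimrecPred fun q : ℕ × α => p q.2 q.1) (hb : Primrec b) :
    PrimrecPred fun a => ∃ x < b a, p a x := by
  have h := (PrimrecRel.exists_mem_list (R := fun x a => p a x) hp).comp
    (Primrec.list_range.comp hb) Primrec.id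
  simpa using h

theorem primrecPred_forall_mem {p : α → β → Prop} {b : α → List β}
    (hp : PrimrecPred fun q : β × α => p q.2 q.1) (hb : Primrec b) :
    PrimrecPred fun a => ∀ x ∈ b a, p a x :=
  (PrimrecRel.forall_mem_list (R := fun x a => p a x) hp).comp hb Primrec.id

theorem primrecPred_exists_mem {p : α → β → Prop} {b : α → List β}
    (hp : PrimrecPred fun q : β × α => p q.2 q.1) (hb : Primrec b) :
    PrimrecPred fun a => ∃ x ∈ b a, p a x :=
  (PrimrecRel.exists_mem_list (R := fun x a => p a x) hp).comp hb Primrec.id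

/-- A projection of a computable predicate is recursively enumerable. -/
theorem REPred.exists_nat {p : α → ℕ → Prop} (hp : ComputablePred fun q : α × ℕ => p q.1 q.2) :
    REPred fun a => ∃ n, p a n := by
  classical
  have h : Partrec fun a => Nat.rfind fun n => Part.some (decide (p a n)) :=
    Partrec.rfind hp.decide.partrec
  refine h.dom_re.of_eq fun a => ?_
  refine Nat.rfind_dom.trans ?_
  simp

/-- The literal `2 * i + b` (with `b < 2`) says that the atom `i` has the truth value `b`. -/
def LitTrue (v : ℕ → Bool) (l : ℕ) : Prop := (v (l / 2)).toNat = l % 2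

/-- The valuation `v` satisfies all clauses of all lists in the sequence `C`. -/
def SatisfiesClauses (v : ℕ → Bool) (C : ℕ → List (List ℕ)) : Prop :=
  ∀ k, ∀ c ∈ C k, ∃ l ∈ c, LitTrue v l

theorem isClosed_litTrue (l : ℕ) : IsClosed {v : ℕ → Bool | LitTrue v l} := by
  have h : Continuous fun v : ℕ → Bool => (v (l / 2)).toNat :=
    (continuous_of_discreteTopology (f := Bool.toNat)).comp (continuous_apply _)
  exact isClosed_eq h continuous_const

/-- Compactness of propositional logic, in a form that is suitable for enumeration. -/
theorem exists_satisfiesClauses_iff (C : ℕ → List (List ℕ)) :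
    (∃ v, SatisfiesClauses v C) ↔
      ∀ N, ∃ s < 2 ^ N, ∀ k < N, ∀ c ∈ C k, ∃ l ∈ c, l / 2 < N → LitTrue s.testBit l := by
  constructor
  · rintro ⟨v, hv⟩ N
    refine ⟨Nat.ofBits fun i : Fin N => v i, Nat.ofBits_lt_two_pow _, fun k _ c hc => ?_⟩
    obtain ⟨l, hl, h⟩ := hv k c hc
    refine ⟨l, hl, fun hlt => ?_⟩
    rw [LitTrue, Nat.testBit_ofBits_lt _ _ hlt]
    exact h
  · intro h
    -- A literal whose atom is at least `N` counts as satisfied, so membership in `F N` depends on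
    -- the first `N` atoms only. The sets are closed and decreasing.
    let F : ℕ → Set (ℕ → Bool) := fun N =>
      {v | ∀ k < N, ∀ c ∈ C k, ∃ l ∈ c, l / 2 < N → LitTrue v l}
    have hclosed : ∀ N, IsClosed (F N) := by
      intro N
      have : F N = ⋂ k, ⋂ (_ : k < N), ⋂ c, ⋂ (_ : c ∈ C k), ⋃ l ∈ {l | l ∈ c},
          {v | l / 2 < N → LitTrue v l} := by
        ext v; simp [F]
      rw [this]
      refine isClosed_iInter fun k => isClosed_iInter fun _ => isClosed_iInter fun c =>
        isClosed_iInter fun _ => c.finite_toSet.isClosed_biUnion fun l _ => ?_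
      by_cases hl : l / 2 < N
      · simpa [hl] using isClosed_litTrue l
      · simp [hl]
    obtain ⟨v, hv⟩ := IsCompact.nonempty_iInter_of_sequence_nonempty_isCompact_isClosed F
      (fun N v hv k hk c hc => by
        obtain ⟨l, hl, h⟩ := hv k (by omega) c hc
        exact ⟨l, hl, fun hlt => h (by omega)⟩)
      (fun N => by obtain ⟨s, -, hs⟩ := h N; exact ⟨_, hs⟩)
      (hclosed 0).isCompact hclosed
    refine ⟨v, fun k c hc => ?_⟩
    -- This stage exceeds `k` and every literal of `c`, so no literal of `c` is satisfied by
    -- default.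
    obtain ⟨l, hl, h⟩ := Set.mem_iInter.1 hv (k + c.sum + 1) k (by omega) c hc
    have := List.le_sum_of_mem hl
    exact ⟨l, hl, h (by omega)⟩

/-- A refutation is a stage `N` at which each of the `2 ^ N` assignments violates a clause. Checking
a stage takes bounded quantifiers only, with bit `i` of `s` read as `s / 2 ^ i % 2`. -/
theorem rePred_not_exists_satisfiesClauses {C : α → ℕ → List (List ℕ)}
    (hC : Primrec fun q : α × ℕ => C q.1 q.2) :
    REPred fun a => ¬ ∃ v, SatisfiesClauses v (C a) := by
  have h : PrimrecPred fun q : α × ℕ => ∀ s < 2 ^ q.2, ∃ k < q.2, ∃ c ∈ C q.1 k, ∀ l ∈ c,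
      l / 2 < q.2 ∧ ¬ s / 2 ^ (l / 2) % 2 = l % 2 := by
    refine primrecPred_forall_lt ?_ (by fun_prop)
    refine primrecPred_exists_lt ?_ (by fun_prop)
    refine primrecPred_exists_mem ?_
      (hC.comp (g := fun q : ℕ × ℕ × α × ℕ => (q.2.2.1, q.1)) (by fun_prop))
    refine primrecPred_forall_mem ?_ (by fun_prop)
    exact (Primrec.nat_lt.comp (by fun_prop) (by fun_prop)).and
      (Primrec.eq.comp (by fun_prop) (by fun_prop)).not
  refine (REPred.exists_nat (p := fun a N => ∀ s < 2 ^ N, ∃ k < N, ∃ c ∈ C a k, ∀ l ∈ c,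
      l / 2 < N ∧ ¬ s / 2 ^ (l / 2) % 2 = l % 2) h.computablePred).of_eq fun a => ?_
  rw [exists_satisfiesClauses_iff]
  push Not
  simp only [LitTrue, Nat.toNat_testBit, ne_eq]

/-! ### Henkin clauses -/

/-- The atom "moment `s` is before moment `t`". -/
def ltAtom (s t : ℕ) : ℕ := 3 * Nat.pair s t

/-- The atom "objects `a` and `b` are equal". -/
def eqAtom (a b : ℕ) : ℕ := 3 * Nat.pair a b + 1

/-- The atom "the formula with code `n` holds at moment `t` for object `a`". -/
def holdsAtom (t a n : ℕ) : ℕ := 3 * Nat.pair t (Nat.pair a n) + 2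

/-- The index of the moment or object that witnesses the truth of the existential formula with
immediate subformula `n` at moment `t` for object `a`. -/
def witness (t a n : ℕ) : ℕ := Nat.pair t (Nat.pair a n) + 1

/-- The positive literal of an atom. -/
def posLit (i : ℕ) : ℕ := 2 * i + 1

/-- The negative literal of an atom. -/
def negLit (i : ℕ) : ℕ := 2 * i

/-- The Henkin clauses of the formula with code `f` for the moments, objects and formulas indexed
by `a`, `b`, `c`, `n`, `m`. -/
def henkinClauses (f a b c n m : ℕ) : List (List ℕ) :=
  [[negLit (ltAtom a a)],
   [negLit (ltAtom a b), negLit (ltAtom b c), posLit (ltAtom a c)],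
   [negLit (ltAtom a c), posLit (ltAtom a b), posLit (ltAtom b c)],
   [posLit (ltAtom a b), posLit (ltAtom b a), negLit (holdsAtom a c (5 * n)),
    posLit (holdsAtom b c (5 * n))],
   [posLit (eqAtom a a)],
   [negLit (eqAtom a b), posLit (eqAtom b a)],
   [negLit (eqAtom a b), negLit (eqAtom b c), posLit (eqAtom a c)],
   [negLit (eqAtom a b), negLit (holdsAtom c a (5 * n)), posLit (holdsAtom c b (5 * n))],
   [posLit (holdsAtom a b n), posLit (holdsAtom a b (5 * n + 1))],
   [negLit (holdsAtom a b n), negLit (holdsAtom a b (5 * n + 1))],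
   [negLit (holdsAtom a b (5 * Nat.pair n m + 2)), posLit (holdsAtom a b n)],
   [negLit (holdsAtom a b (5 * Nat.pair n m + 2)), posLit (holdsAtom a b m)],
   [posLit (holdsAtom a b (5 * Nat.pair n m + 2)), negLit (holdsAtom a b n),
    negLit (holdsAtom a b m)],
   [negLit (ltAtom a c), negLit (holdsAtom c b n), posLit (holdsAtom a b (5 * n + 3))],
   [negLit (holdsAtom a b (5 * n + 3)), posLit (ltAtom a (witness a b n))],
   [negLit (holdsAtom a b (5 * n + 3)), posLit (holdsAtom (witness a b n) b n)],
   [posLit (eqAtom b c), negLit (holdsAtom a c n), posLit (holdsAtom a b (5 * n + 4))],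
   [negLit (holdsAtom a b (5 * n + 4)), negLit (eqAtom b (witness a b n))],
   [negLit (holdsAtom a b (5 * n + 4)), posLit (holdsAtom a (witness a b n) n)],
   [posLit (holdsAtom 0 0 f)]]

/-- The sequence of all Henkin clauses of the formula with code `f`. -/
def henkinSequence (f k : ℕ) : List (List ℕ) :=
  henkinClauses f k.unpair.1 k.unpair.2.unpair.1 k.unpair.2.unpair.2.unpair.1
    k.unpair.2.unpair.2.unpair.2.unpair.1 k.unpair.2.unpair.2.unpair.2.unpair.2

theorem primrec_henkinSequence {f : α → ℕ} (hf : Primrec f) :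
    Primrec fun q : α × ℕ => henkinSequence (f q.1) q.2 := by
  unfold henkinSequence henkinClauses posLit negLit witness holdsAtom eqAtom ltAtom
  fun_prop

end PrimrecFunProp

end FOLTL

/-! ### Henkin valuations and constant domain models -/

namespace FOLTL

/-- A Henkin valuation for the formula with code `f`: `L` is the order of moments, `E` the equality
of objects, and `H t a n` the truth of the formula with code `n` at moment `t` for object `a`. -/
structure IsHenkin (L E : ℕ → ℕ → Prop) (H : ℕ → ℕ → ℕ → Prop) (f : ℕ) : Prop where
  irrefl a : ¬ L a a
  trans a b c : L a b → L b c → L a c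
  cotrans a b c : L a c → L a b ∨ L b c
  time_congr a b c n : ¬ L a b → ¬ L b a → H a c (5 * n) → H b c (5 * n)
  eq_refl a : E a a
  eq_symm a b : E a b → E b a
  eq_trans a b c : E a b → E b c → E a c
  obj_congr a b c n : E a b → H c a (5 * n) → H c b (5 * n)
  holds_neg a b n : H a b (5 * n + 1) ↔ ¬ H a b n
  holds_and a b n m : H a b (5 * Nat.pair n m + 2) ↔ H a b n ∧ H a b m
  holds_diamF a b c n : L a c → H c b n → H a b (5 * n + 3)
  lt_witness a b n : H a b (5 * n + 3) → L a (witness a b n)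
  holds_witness a b n : H a b (5 * n + 3) → H (witness a b n) b n
  holds_exNe a b c n : ¬ E b c → H a c n → H a b (5 * n + 4)
  ne_witness a b n : H a b (5 * n + 4) → ¬ E b (witness a b n)
  holds_witness_exNe a b n : H a b (5 * n + 4) → H a (witness a b n) n
  goal : H 0 0 f

theorem litTrue_pos (v : ℕ → Bool) (i : ℕ) : LitTrue v (posLit i) ↔ v i = true := by
  have h1 : (2 * i + 1) / 2 = i := by omega
  have h2 : (2 * i + 1) % 2 = 1 := by omega
  cases h : v i <;> simp [LitTrue, posLit, h1, h2, h]

theorem litTrue_neg (v : ℕ → Bool) (i : ℕ) : LitTrue v (negLit i) ↔ ¬ v i = true := by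
  cases h : v i <;> simp [LitTrue, negLit, h]

theorem satisfiesClauses_henkinSequence_iff (v : ℕ → Bool) (f : ℕ) :
    SatisfiesClauses v (henkinSequence f) ↔
      ∀ a b c n m, ∀ d ∈ henkinClauses f a b c n m, ∃ l ∈ d, LitTrue v l := by
  refine ⟨fun h a b c n m d hd => ?_, fun h k d hd => h _ _ _ _ _ d hd⟩
  refine h (Nat.pair a (Nat.pair b (Nat.pair c (Nat.pair n m)))) d ?_
  simpa [henkinSequence] using hd

theorem satisfiesClauses_iff_isHenkin (v : ℕ → Bool) (f : ℕ) :
    SatisfiesClauses v (henkinSequence f) ↔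
      IsHenkin (fun a b => v (ltAtom a b) = true) (fun a b => v (eqAtom a b) = true)
        (fun t a n => v (holdsAtom t a n) = true) f := by
  rw [satisfiesClauses_henkinSequence_iff]
  constructor
  · intro h
    simp only [henkinClauses, List.forall_mem_cons, List.exists_mem_cons_iff, litTrue_pos,
      litTrue_neg, List.not_mem_nil, false_and, exists_false, or_false, false_imp_iff,
      forall_const] at h
    constructor
    · intro a
      have h1 := (h a a a 0 0).1
      tauto
    · intro a b c
      have h2 := (h a b c 0 0).2.1
      tauto
    · intro a b c
      have h3 := (h a b c 0 0).2.2.1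
      tauto
    · intro a b c n
      have h4 := (h a b c n 0).2.2.2.1
      tauto
    · intro a
      have h5 := (h a a a 0 0).2.2.2.2.1
      tauto
    · intro a b
      have h6 := (h a b a 0 0).2.2.2.2.2.1
      tauto
    · intro a b c
      have h7 := (h a b c 0 0).2.2.2.2.2.2.1
      tauto
    · intro a b c n
      have h8 := (h a b c n 0).2.2.2.2.2.2.2.1
      tauto
    · intro a b n
      have h9 := (h a b a n 0).2.2.2.2.2.2.2.2.1
      have h10 := (h a b a n 0).2.2.2.2.2.2.2.2.2.1
      tauto
    · intro a b n m
      have h11 := (h a b a n m).2.2.2.2.2.2.2.2.2.2.1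
      have h12 := (h a b a n m).2.2.2.2.2.2.2.2.2.2.2.1
      have h13 := (h a b a n m).2.2.2.2.2.2.2.2.2.2.2.2.1
      tauto
    · intro a b c n
      have h14 := (h a b c n 0).2.2.2.2.2.2.2.2.2.2.2.2.2.1
      tauto
    · intro a b n
      have h15 := (h a b a n 0).2.2.2.2.2.2.2.2.2.2.2.2.2.2.1
      tauto
    · intro a b n
      have h16 := (h a b a n 0).2.2.2.2.2.2.2.2.2.2.2.2.2.2.2.1
      tauto
    · intro a b c n
      have h17 := (h a b c n 0).2.2.2.2.2.2.2.2.2.2.2.2.2.2.2.2.1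
      tauto
    · intro a b n
      have h18 := (h a b a n 0).2.2.2.2.2.2.2.2.2.2.2.2.2.2.2.2.2.1
      tauto
    · intro a b n
      have h19 := (h a b a n 0).2.2.2.2.2.2.2.2.2.2.2.2.2.2.2.2.2.2.1
      tauto
    · have h20 := (h 0 0 0 0 0).2.2.2.2.2.2.2.2.2.2.2.2.2.2.2.2.2.2.2.1
      tauto
  · intro h a b c n m
    simp only [henkinClauses, List.forall_mem_cons, List.exists_mem_cons_iff, litTrue_pos,
      litTrue_neg, List.not_mem_nil, false_and, exists_false, or_false, false_imp_iff,
      forall_const, and_true]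
    refine ⟨?_, ?_, ?_, ?_, ?_, ?_, ?_, ?_, ?_, ?_, ?_, ?_, ?_, ?_, ?_, ?_, ?_, ?_, ?_, ?_⟩
    · have := h.irrefl a
      tauto
    · have := h.trans a b c
      tauto
    · have := h.cotrans a b c
      tauto
    · have := h.time_congr a b c n
      tauto
    · have := h.eq_refl a
      tauto
    · have := h.eq_symm a b
      tauto
    · have := h.eq_trans a b c
      tauto
    · have := h.obj_congr a b c n
      tauto
    · have := h.holds_neg a b n
      tauto
    · have := h.holds_neg a b n
      tauto
    · have := h.holds_and a b n m
      tauto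
    · have := h.holds_and a b n m
      tauto
    · have := h.holds_and a b n m
      tauto
    · have := h.holds_diamF a b c n
      tauto
    · have := h.lt_witness a b n
      tauto
    · have := h.holds_witness a b n
      tauto
    · have := h.holds_exNe a b c n
      tauto
    · have := h.ne_witness a b n
      tauto
    · have := h.holds_witness_exNe a b n
      tauto
    · have := h.goal
      tauto

theorem exists_satisfiesClauses_of_isHenkin {L E : ℕ → ℕ → Prop} {H : ℕ → ℕ → ℕ → Prop} {f : ℕ}
    (h : IsHenkin L E H f) : ∃ v, SatisfiesClauses v (henkinSequence f) := by
  classical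
  -- The residue modulo 3 gives the kind of the atom, the quotient its arguments.
  refine ⟨fun i => decide (if i % 3 = 0 then L (i / 3).unpair.1 (i / 3).unpair.2
    else if i % 3 = 1 then E (i / 3).unpair.1 (i / 3).unpair.2
    else H (i / 3).unpair.1 (i / 3).unpair.2.unpair.1 (i / 3).unpair.2.unpair.2), ?_⟩
  rw [satisfiesClauses_iff_isHenkin]
  have h1 (x : ℕ) : (3 * x + 1) % 3 = 1 ∧ (3 * x + 1) / 3 = x := by omega
  have h2 (x : ℕ) : (3 * x + 2) % 3 = 2 ∧ (3 * x + 2) / 3 = x := by omega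
  simpa [ltAtom, eqAtom, holdsAtom, h1, h2] using h

section ModelOfHenkin

variable {L E : ℕ → ℕ → Prop} {H : ℕ → ℕ → ℕ → Prop} {f : ℕ}

/-- The type of indices of moments of a Henkin valuation. -/
def IsHenkin.Moment (_ : IsHenkin L E H f) : Type := ℕ

/-- `L` is a strict weak order: reading `¬ L b a` as `a ≤ b`, cotransitivity of `L` becomes
transitivity. Distinct indices may be incomparable under `L`; they then name the same moment. -/
instance (h : IsHenkin L E H f) : Preorder h.Moment where
  le a b := ¬ L b a
  lt a b := L a b
  le_refl := h.irrefl
  le_trans a b c hab hbc hca := (h.cotrans c b a hca).elim hbc hab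
  lt_iff_le_not_ge a b := by
    refine ⟨fun hab => ⟨fun hba => h.irrefl a (h.trans a b a hab hba), fun hn => hn hab⟩,
      fun hn => not_not.1 hn.2⟩

/-- Moments are the classes of `L`-incomparable indices, objects the classes of `E`. The clauses
demand congruence for atomic formulas only (codes `5 * n`); induction on formulas in `truth` does
the rest. -/
theorem IsHenkin.constantDomainSatisfiable {P : Type u} [Denumerable P] {φ : Formula P}
    (h : IsHenkin L E H (Encodable.encode φ)) : ConstantDomainSatisfiable.{u, v, w} φ := by
  classical
  have : Std.Total (α := h.Moment) (· ≤ ·) := ⟨fun a b => by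
    by_contra hn
    have hn' : ¬ (¬ L b a ∨ ¬ L a b) := hn
    push Not at hn'
    exact h.irrefl a (h.trans a b a hn'.2 hn'.1)⟩
  let S : Setoid ℕ := ⟨E, h.eq_refl, fun {a b} => h.eq_symm a b, fun {a b c} => h.eq_trans a b c⟩
  let T := Antisymmetrization h.Moment (· ≤ ·)
  let tm : ℕ → ULift.{v} T := fun t => ⟨toAntisymmetrization (α := h.Moment) (· ≤ ·) t⟩
  let ob : ℕ → ULift.{w} (Quotient S) := fun a => ⟨Quotient.mk S a⟩
  have htm : ∀ t : ULift.{v} T, ∃ s, t = tm s := by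
    rintro ⟨t⟩
    induction t using Quotient.inductionOn with
    | _ s => exact ⟨s, rfl⟩
  have hob : ∀ t : ULift.{w} (Quotient S), ∃ s, t = ob s := by
    rintro ⟨t⟩
    induction t using Quotient.inductionOn with
    | _ s => exact ⟨s, rfl⟩
  have hlt : ∀ a b, tm a < tm b ↔ L a b := fun a b => Iff.rfl
  have htmeq : ∀ a b, tm a = tm b → ¬ L a b ∧ ¬ L b a := fun a b hab =>
    ⟨fun hl => (((hlt a b).2 hl).ne hab).elim, fun hl => (((hlt b a).2 hl).ne hab.symm).elim⟩
  have hobeq : ∀ a b, ob a = ob b ↔ E a b := fun a b => by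
    simp only [ob, ULift.up_inj]
    exact Quotient.eq (r := S)
  let M : Model.{u, v, w} P (ULift.{v} T) :=
    { U := ULift.{w} (Quotient S)
      dom := fun _ => Set.univ
      dom_nonempty := fun _ => ⟨ob 0, trivial⟩
      interp := fun t p => {x | ∃ s a, t = tm s ∧ x = ob a ∧ H s a (5 * Encodable.encode p)}
      interp_subset := fun _ _ => Set.subset_univ _ }
  have truth : ∀ (ψ : Formula P) (t a : ℕ), M.Holds (tm t) (ob a) ψ ↔ H t a ψ.toNat := by
    intro ψ
    induction ψ with
    | pred p =>
      intro t a
      constructor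
      · rintro ⟨s, b, hs, hb, hH⟩
        have h1 := htmeq t s hs
        have h2 := (hobeq a b).1 hb
        exact h.time_congr s t a _ h1.2 h1.1 (h.obj_congr b a s _ (h.eq_symm _ _ h2) hH)
      · exact fun hH => ⟨t, a, rfl, rfl, hH⟩
    | neg ψ ih => intro t a; rw [Formula.toNat, h.holds_neg, ← ih]; rfl
    | and ψ χ ih1 ih2 => intro t a; rw [Formula.toNat, h.holds_and, ← ih1, ← ih2]; rfl
    | diamF ψ ih =>
      intro t a
      constructor
      · rintro ⟨s, hs, -, hH⟩
        obtain ⟨s, rfl⟩ := htm s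
        exact h.holds_diamF t a s _ hs ((ih s a).1 hH)
      · intro hH
        exact ⟨tm (witness t a ψ.toNat), h.lt_witness _ _ _ hH, trivial,
          (ih _ _).2 (h.holds_witness _ _ _ hH)⟩
    | exNe ψ ih =>
      intro t a
      constructor
      · rintro ⟨b, -, hb, hH⟩
        obtain ⟨b, rfl⟩ := hob b
        exact h.holds_exNe t a b _ (fun he => hb ((hobeq a b).2 he).symm) ((ih t b).1 hH)
      · intro hH
        exact ⟨ob (witness t a ψ.toNat), trivial,
          fun he => h.ne_witness _ _ _ hH ((hobeq _ _).1 he.symm),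
          (ih _ _).2 (h.holds_witness_exNe _ _ _ hH)⟩
  exact ⟨ULift.{v} T, inferInstance, M, fun _ _ _ => rfl, tm 0, ob 0, trivial,
    (truth φ 0 0).2 h.goal⟩

end ModelOfHenkin

/-- Indices for moments and objects, with given starting points and witnesses. -/
def witnessSequence {X Y : Type*} (x₀ : X) (y₀ : Y) (F : X → Y → ℕ → X × Y) : ℕ → X × Y
  | 0 => (x₀, y₀)
  | k + 1 =>
    have _h₁ : k.unpair.1 < k + 1 := Nat.lt_succ_of_le (Nat.unpair_left_le k)
    have _h₂ : k.unpair.2.unpair.1 < k + 1 :=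
      Nat.lt_succ_of_le ((Nat.unpair_left_le _).trans (Nat.unpair_right_le k))
    F (witnessSequence x₀ y₀ F k.unpair.1).1 (witnessSequence x₀ y₀ F k.unpair.2.unpair.1).2
      k.unpair.2.unpair.2

theorem witnessSequence_witness {X Y : Type*} (x₀ : X) (y₀ : Y) (F : X → Y → ℕ → X × Y)
    (t a n : ℕ) : witnessSequence x₀ y₀ F (witness t a n) =
      F (witnessSequence x₀ y₀ F t).1 (witnessSequence x₀ y₀ F a).2 n := by
  rw [witness, witnessSequence]
  simp

/-- Downward Löwenheim–Skolem. `F` chooses a later moment and another object as witnesses. As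
`witness t a n` exceeds `t` and `a`, recursion indexes a family closed under `F`, with index `0`
left for the given moment and object. The indexing need not be injective. -/
theorem exists_isHenkin {P : Type u} [Denumerable P] {φ : Formula P}
    (h : ConstantDomainSatisfiable.{u, v, w} φ) :
    ∃ L E H, IsHenkin L E H (Encodable.encode φ) := by
  obtain ⟨T, _, M, hM, t₀, a₀, ha₀, hφ⟩ := h
  have hdom : ∀ t, M.dom t = M.dom t₀ := fun t => by
    rcases lt_trichotomy t t₀ with h | rfl | h
    exacts [hM _ _ h, rfl, (hM _ _ h).symm]
  have hF : ∀ (t : T) (a : M.dom t₀) (n : ℕ), ∃ q : T × M.dom t₀,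
      (M.Holds t a (.diamF (Denumerable.ofNat (Formula P) n)) →
        t < q.1 ∧ M.Holds q.1 a (Denumerable.ofNat (Formula P) n)) ∧
      (M.Holds t a (.exNe (Denumerable.ofNat (Formula P) n)) →
        q.2 ≠ a ∧ M.Holds t q.2 (Denumerable.ofNat (Formula P) n)) := by
    intro t a n
    have h1 : ∃ s : T, M.Holds t a (.diamF (Denumerable.ofNat (Formula P) n)) →
        t < s ∧ M.Holds s a (Denumerable.ofNat (Formula P) n) := by
      by_cases h : M.Holds t a (.diamF (Denumerable.ofNat (Formula P) n))
      · obtain ⟨s, hs, -, hs'⟩ := h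
        exact ⟨s, fun _ => ⟨hs, hs'⟩⟩
      · exact ⟨t, fun h' => (h h').elim⟩
    have h2 : ∃ b : M.dom t₀, M.Holds t a (.exNe (Denumerable.ofNat (Formula P) n)) →
        b ≠ a ∧ M.Holds t b (Denumerable.ofNat (Formula P) n) := by
      by_cases h : M.Holds t a (.exNe (Denumerable.ofNat (Formula P) n))
      · obtain ⟨b, hb, hne, hb'⟩ := h
        exact ⟨⟨b, hdom t ▸ hb⟩, fun _ => ⟨fun he => hne (congrArg Subtype.val he), hb'⟩⟩
      · exact ⟨a, fun h' => (h h').elim⟩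
    obtain ⟨s, hs⟩ := h1
    obtain ⟨b, hb⟩ := h2
    exact ⟨(s, b), hs, hb⟩
  choose F hF1 hF2 using hF
  let x : ℕ → T := fun k => (witnessSequence t₀ (⟨a₀, ha₀⟩ : M.dom t₀) F k).1
  let y : ℕ → M.dom t₀ := fun k => (witnessSequence t₀ (⟨a₀, ha₀⟩ : M.dom t₀) F k).2
  have hx : x 0 = t₀ := by simp only [x, witnessSequence]
  have hy : y 0 = ⟨a₀, ha₀⟩ := by simp only [y, witnessSequence]
  have code : ∀ ψ : Formula P, Denumerable.ofNat (Formula P) ψ.toNat = ψ := fun ψ =>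
    Denumerable.ofNat_encode ψ
  have decode : ∀ n, (Denumerable.ofNat (Formula P) n).toNat = n := fun n =>
    Formula.toNat_ofNat n
  have hpred : ∀ n, Denumerable.ofNat (Formula P) (5 * n) = .pred (Denumerable.ofNat P n) :=
    fun n => by rw [← code (.pred _), Formula.toNat, Denumerable.encode_ofNat]
  have hneg : ∀ n, Denumerable.ofNat (Formula P) (5 * n + 1) =
      .neg (Denumerable.ofNat (Formula P) n) :=
    fun n => by rw [← code (.neg _), Formula.toNat, decode]
  have hand : ∀ n m, Denumerable.ofNat (Formula P) (5 * Nat.pair n m + 2) =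
      .and (Denumerable.ofNat (Formula P) n) (Denumerable.ofNat (Formula P) m) :=
    fun n m => by rw [← code (.and _ _), Formula.toNat, decode, decode]
  have hdiam : ∀ n, Denumerable.ofNat (Formula P) (5 * n + 3) =
      .diamF (Denumerable.ofNat (Formula P) n) :=
    fun n => by rw [← code (.diamF _), Formula.toNat, decode]
  have hex : ∀ n, Denumerable.ofNat (Formula P) (5 * n + 4) =
      .exNe (Denumerable.ofNat (Formula P) n) :=
    fun n => by rw [← code (.exNe _), Formula.toNat, decode]
  have hw1 : ∀ t a n, x (witness t a n) = (F (x t) (y a) n).1 := fun t a n => by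
    simp only [x, y, witnessSequence_witness]
  have hw2 : ∀ t a n, y (witness t a n) = (F (x t) (y a) n).2 := fun t a n => by
    simp only [x, y, witnessSequence_witness]
  refine ⟨fun s t => x s < x t, fun a b => y a = y b,
    fun t a n => M.Holds (x t) (y a) (Denumerable.ofNat (Formula P) n), ?_⟩
  constructor
  · exact fun a => lt_irrefl _
  · exact fun a b c => lt_trans
  · intro a b c hac
    by_contra! hn
    exact absurd (hn.2.trans hn.1) (not_le.2 hac)
  · intro a b c n h1 h2 hH
    rwa [le_antisymm (not_lt.1 h1) (not_lt.1 h2)]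
  · exact fun a => rfl
  · exact fun a b => Eq.symm
  · exact fun a b c => Eq.trans
  · intro a b c n hab hH
    rwa [← hab]
  · intro a b n; rw [hneg]; rfl
  · intro a b n m; rw [hand]; rfl
  · intro a b c n hac hH
    rw [hdiam]
    exact ⟨x c, hac, by rw [hdom]; exact (y b).2, hH⟩
  · intro a b n hH
    rw [hdiam] at hH
    rw [hw1]; exact (hF1 _ _ _ hH).1
  · intro a b n hH
    rw [hdiam] at hH
    rw [hw1]; exact (hF1 _ _ _ hH).2
  · intro a b c n hbc hH
    rw [hex]
    exact ⟨y c, by rw [hdom]; exact (y c).2, fun he => hbc (Subtype.ext he).symm, hH⟩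
  · intro a b n hH
    rw [hex] at hH
    rw [hw2]; exact fun he => (hF2 _ _ _ hH).1 he.symm
  · intro a b n hH
    rw [hex] at hH
    rw [hw2]; exact (hF2 _ _ _ hH).2
  · rw [hx, hy, Denumerable.ofNat_encode]; exact hφ

theorem constantDomainSatisfiable_iff_exists_satisfiesClauses {P : Type u} [Denumerable P]
    (φ : Formula P) : ConstantDomainSatisfiable.{u, v, w} φ ↔
      ∃ v, SatisfiesClauses v (henkinSequence (Encodable.encode φ)) := by
  constructor
  · intro h
    obtain ⟨L, E, H, h⟩ := exists_isHenkin h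
    exact exists_satisfiesClauses_of_isHenkin h
  · rintro ⟨v, hv⟩
    exact ((satisfiesClauses_iff_isHenkin v _).1 hv).constantDomainSatisfiable

theorem rePred_not_constantDomainSatisfiable (P : Type u) [Denumerable P] :
    REPred fun φ : Formula P => ¬ ConstantDomainSatisfiable.{u, v, w} φ :=
  (rePred_not_exists_satisfiesClauses
      (C := fun φ : Formula P => henkinSequence (Encodable.encode φ))
      (primrec_henkinSequence Primrec.encode)).of_eq fun φ =>
    not_congr (constantDomainSatisfiable_iff_exists_satisfiesClauses φ).symm

end FOLTL

namespace FOLTL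

/-! ### Register machines -/

/-- The instructions of a register machine with states in `Q`. -/
inductive Instr (Q : Type*)
  /-- stop -/
  | halt : Instr Q
  /-- change the state -/
  | goto (q : Q) : Instr Q
  /-- increment the register `r` -/
  | inc (r : ℕ) (q : Q) : Instr Q
  /-- go to `q₀` if the register `r` is zero, otherwise decrement it and go to `q₁` -/
  | branch (r : ℕ) (q₀ q₁ : Q) : Instr Q

/-- One step of a register machine. -/
def step {Q : Type*} (M : Q → Instr Q) (c : Q × (ℕ → ℕ)) : Q × (ℕ → ℕ) :=
  match M c.1 with
  | .halt => c
  | .goto q => (q, c.2)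
  | .inc r q => (q, Function.update c.2 r (c.2 r + 1))
  | .branch r q₀ q₁ => if c.2 r = 0 then (q₀, c.2) else (q₁, Function.update c.2 r (c.2 r - 1))

/-- Structured programs for register machines. -/
inductive Prog
  /-- do nothing -/
  | skip : Prog
  /-- increment the register `r` -/
  | inc (r : ℕ) : Prog
  /-- while the register `r` is not zero, decrement it and execute `p` -/
  | loop (r : ℕ) (p : Prog) : Prog
  /-- execute `p` and then `q` -/
  | seq (p q : Prog) : Prog
  deriving Countable

namespace Prog

/-- The register machine that executes lists of programs. -/
def machine : List Prog → Instr (List Prog)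
  | [] => .halt
  | skip :: K => .goto K
  | inc r :: K => .inc r K
  | loop r p :: K => .branch r K (p :: loop r p :: K)
  | seq p q :: K => .goto (p :: q :: K)

/-- Execution of `p` from the store `s` terminates with the store `s'`. -/
def Runs (p : Prog) (s s' : ℕ → ℕ) : Prop :=
  ∀ K, ∃ n, (step machine)^[n] (p :: K, s) = (K, s')

theorem runs_skip (s : ℕ → ℕ) : Runs skip s s := fun _ => ⟨1, rfl⟩

theorem runs_inc (r : ℕ) (s : ℕ → ℕ) : Runs (inc r) s (Function.update s r (s r + 1)) :=
  fun _ => ⟨1, rfl⟩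

/-- Runs compose because `Runs` quantifies over the continuation: `p` is run in front of `q :: K`.
-/
theorem Runs.seq {p q : Prog} {s s' s'' : ℕ → ℕ} (hp : Runs p s s') (hq : Runs q s' s'') :
    Runs (p.seq q) s s'' := fun K => by
  obtain ⟨n, hn⟩ := hp (q :: K)
  obtain ⟨m, hm⟩ := hq K
  refine ⟨m + n + 1, ?_⟩
  rw [Function.iterate_succ_apply, Function.iterate_add_apply]
  change (step machine)^[m] ((step machine)^[n] (p :: q :: K, s)) = _
  rw [hn, hm]

theorem runs_loop_zero {r : ℕ} {s : ℕ → ℕ} (p : Prog) (h : s r = 0) : Runs (loop r p) s s :=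
  fun K => ⟨1, by simp [step, machine, h]⟩

theorem step_loop_of_ne_zero {r : ℕ} {s : ℕ → ℕ} (p : Prog) (K : List Prog) (h : s r ≠ 0) :
    step machine (loop r p :: K, s) =
      (p :: loop r p :: K, Function.update s r (s r - 1)) := by
  simp [step, machine, h]

theorem Runs.loop {r : ℕ} {p : Prog} {s s' s'' : ℕ → ℕ} (h : s r ≠ 0)
    (hp : Runs p (Function.update s r (s r - 1)) s') (hl : Runs (loop r p) s' s'') :
    Runs (loop r p) s s'' := fun K => by
  obtain ⟨n, hn⟩ := hp (Prog.loop r p :: K)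
  obtain ⟨m, hm⟩ := hl K
  refine ⟨m + n + 1, ?_⟩
  rw [Function.iterate_succ_apply, Function.iterate_add_apply, step_loop_of_ne_zero p K h, hn, hm]

/-- The invariant rule for loops. -/
theorem exists_runs_loop {r : ℕ} {p : Prog} (I : ℕ → (ℕ → ℕ) → Prop)
    (hr : ∀ n s, I n s → s r = n)
    (hI : ∀ n s, I (n + 1) s → ∃ s', Runs p (Function.update s r n) s' ∧ I n s')
    (n : ℕ) (s : ℕ → ℕ) (h : I n s) : ∃ s', Runs (loop r p) s s' ∧ I 0 s' := by
  induction n generalizing s with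
  | zero => exact ⟨s, runs_loop_zero p (hr _ _ h), h⟩
  | succ n ih =>
    obtain ⟨s', h1, h2⟩ := hI n s h
    obtain ⟨s'', h3, h4⟩ := ih s' h2
    have hs := hr _ _ h
    refine ⟨s'', Runs.loop (by omega) ?_ h3, h4⟩
    rwa [hs, Nat.add_sub_cancel]

/-- The program `p` assigns the value of `F` to the register `y` without changing the other
registers below `b`. -/
def Assigns (p : Prog) (b y : ℕ) (F : (ℕ → ℕ) → ℕ) : Prop :=
  ∀ s, ∃ s', Runs p s s' ∧ s' y = F s ∧ ∀ r < b, r ≠ y → s' r = s r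

theorem assigns_clear (b y : ℕ) : Assigns (loop y skip) b y fun _ => 0 := fun s => by
  obtain ⟨s', h1, h2, h3⟩ := exists_runs_loop (r := y) (p := skip)
    (fun n s' => s' y = n ∧ ∀ r < b, r ≠ y → s' r = s r) (fun n s h => h.1)
    (fun n s' h => ⟨_, runs_skip _, by simp, fun r hr hy => by simp [hy, h.2 r hr hy]⟩)
    (s y) s ⟨rfl, fun _ _ _ => rfl⟩
  exact ⟨s', h1, h2, h3⟩

/-- Reading a register empties it, so `x` is drained into both `y` and the scratch register `b`, and
then refilled from `b`. `Assigns` promises nothing about registers from `b` on. -/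
theorem exists_assigns_copy {b x y : ℕ} (hx : x < b) (hy : y < b) (hxy : x ≠ y) :
    ∃ p, Assigns p b y fun s => s x := by
  refine ⟨((loop y skip).seq (loop b skip)).seq
    ((loop x ((inc y).seq (inc b))).seq (loop b (inc x))), fun s => ?_⟩
  obtain ⟨s₁, r₁, e₁, f₁⟩ := assigns_clear (b + 1) y s
  obtain ⟨s₂, r₂, e₂, f₂⟩ := assigns_clear (b + 1) b s₁
  obtain ⟨s₃, r₃, e₃⟩ := exists_runs_loop (r := x) (p := (inc y).seq (inc b))
    (fun n t => t x = n ∧ t y + n = s x ∧ t b + n = s x ∧ ∀ r < b, r ≠ x → r ≠ y → t r = s r)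
    (fun n s h => h.1)
    (fun n t ⟨h1, h2, h3, h4⟩ => by
      refine ⟨_, (runs_inc _ _).seq (runs_inc _ _), ?_⟩
      have : x ≠ b := by omega
      have : y ≠ b := by omega
      refine ⟨?_, ?_, ?_, fun r hr hrx hry => ?_⟩
      · simp [*]
      · simp [*, hxy.symm]; omega
      · simp [*, Ne.symm]; omega
      · have : r ≠ b := by omega
        simp [*])
    (s x) s₂
    ⟨by rw [f₂ x (by omega) (by omega), f₁ x (by omega) hxy],
      by rw [f₂ y (by omega) (by omega), e₁, zero_add], by rw [e₂, zero_add],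
      fun r hr _ hry => by rw [f₂ r (by omega) (by omega), f₁ r (by omega) hry]⟩
  obtain ⟨h1, h2, h3, h4⟩ := e₃
  obtain ⟨s₄, r₄, e₄⟩ := exists_runs_loop (r := b) (p := inc x)
    (fun n t => t b = n ∧ t x + n = s x ∧ t y = s x ∧ ∀ r < b, r ≠ x → r ≠ y → t r = s r)
    (fun n s h => h.1)
    (fun n t ⟨h1, h2, h3, h4⟩ => by
      refine ⟨_, runs_inc _ _, ?_⟩
      have : x ≠ b := by omega
      have : y ≠ b := by omega
      refine ⟨?_, ?_, ?_, fun r hr hrx hry => ?_⟩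
      · simp [Ne.symm, *]
      · simp [*]; omega
      · simp [*, hxy.symm]
      · have : r ≠ b := by omega
        simp [*])
    (s₃ b) s₃ ⟨rfl, by omega, by omega, h4⟩
  refine ⟨s₄, (r₁.seq r₂).seq (r₃.seq r₄), e₄.2.2.1, fun r hr hry => ?_⟩
  by_cases hrx : r = x
  · rw [hrx]; exact e₄.2.1
  · exact e₄.2.2.2 r hr hrx hry

/-- Several assignments in succession, to the registers from `b` on. -/
theorem exists_runs_assigns {b m : ℕ} (F : ℕ → (ℕ → ℕ) → ℕ)
    (hF : ∀ i s s', (∀ r < b, s' r = s r) → F i s' = F i s)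
    (k : ℕ) (hk : k ≤ m) (hp : ∀ i < k, ∃ p, Assigns p (b + m) (b + i) (F i)) :
    ∃ p, ∀ s, ∃ s', Runs p s s' ∧ (∀ i < k, s' (b + i) = F i s) ∧ ∀ r < b, s' r = s r := by
  induction k with
  | zero => exact ⟨skip, fun s => ⟨s, runs_skip s, by simp, by simp⟩⟩
  | succ k ih =>
    obtain ⟨p, h⟩ := ih (by omega) fun i hi => hp i (by omega)
    obtain ⟨q, h'⟩ := hp k (by omega)
    refine ⟨p.seq q, fun s => ?_⟩
    obtain ⟨s₁, r₁, e₁, f₁⟩ := h s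
    obtain ⟨s₂, r₂, e₂, f₂⟩ := h' s₁
    refine ⟨s₂, r₁.seq r₂, fun i hi => ?_, fun r hr => ?_⟩
    · rcases Nat.lt_succ_iff_lt_or_eq.1 hi with hi | rfl
      · rw [f₂ _ (by omega) (by omega), e₁ i hi]
      · rw [e₂, hF _ _ _ f₁]
    · rw [f₂ r (by omega) (by omega), f₁ r hr]

/-- Primitive recursive functions can be computed by register machines. -/
theorem exists_assigns_of_primrec {n : ℕ} {f : List.Vector ℕ n → ℕ} (hf : Nat.Primrec' f) :
    ∀ (x : Fin n → ℕ) (y b : ℕ), (∀ i, x i < b) → y < b → (∀ i, x i ≠ y) →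
      ∃ p, Assigns p b y fun s => f (List.Vector.ofFn fun i => s (x i)) := by
  induction hf with
  | zero => exact fun _ y b _ _ _ => ⟨_, assigns_clear b y⟩
  | succ =>
    intro x y b hx hy hxy
    obtain ⟨p, hp⟩ := exists_assigns_copy (hx 0) hy (hxy 0)
    refine ⟨p.seq (inc y), fun s => ?_⟩
    obtain ⟨s₁, r₁, e₁, f₁⟩ := hp s
    refine ⟨_, r₁.seq (runs_inc _ _), ?_, fun r hr hry => ?_⟩
    · simp [e₁]
    · simp [hry, f₁ r hr hry]
  | get i =>
    intro x y b hx hy hxy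
    obtain ⟨p, hp⟩ := exists_assigns_copy (hx i) hy (hxy i)
    exact ⟨p, by simpa using hp⟩
  | @comp n m f g _ _ ihf ihg =>
    intro x y b hx hy hxy
    -- The value of the inner function `g i` goes to register `b + i`; the scratch space of the
    -- subprograms begins at `b + m`.
    let F : ℕ → (ℕ → ℕ) → ℕ := fun i s =>
      if h : i < m then g ⟨i, h⟩ (List.Vector.ofFn fun i => s (x i)) else 0
    obtain ⟨p, hp⟩ := exists_runs_assigns (b := b) (m := m) F
      (fun i s s' h => by simp only [F, h _ (hx _)]) m le_rfl
      (fun i hi => by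
        simp only [F, hi, dite_true]
        exact ihg ⟨i, hi⟩ x (b + i) (b + m) (fun j => by have := hx j; omega) (by omega)
          (fun j => by have := hx j; omega))
    obtain ⟨q, hq⟩ := ihf (fun i => b + i) y (b + m) (fun j => by omega) (by omega)
      (fun j => by omega)
    refine ⟨p.seq q, fun s => ?_⟩
    obtain ⟨s₁, r₁, e₁, f₁⟩ := hp s
    obtain ⟨s₂, r₂, e₂, f₂⟩ := hq s₁
    refine ⟨s₂, r₁.seq r₂, ?_, fun r hr hry => by rw [f₂ r (by omega) hry, f₁ r hr]⟩
    rw [e₂]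
    beta_reduce
    congr 2
    funext i
    rw [e₁ i i.2]
    simp [F]
  | @prec n f g _ _ ihf ihg =>
    intro x y b hx hy hxy
    -- Register `b` counts the remaining iterations and `b + 1` the completed ones. Since `y` is an
    -- argument of `g`, the new value is formed in `b + 2` and then copied to `y`.
    obtain ⟨p₁, h₁⟩ := exists_assigns_copy (b := b + 3) (x := x 0) (y := b)
      (by have := hx 0; omega) (by omega) (by have := hx 0; omega)
    have h₂ := assigns_clear (b + 3) (b + 1)
    obtain ⟨p₃, h₃⟩ := ihf (fun i => x i.succ) y (b + 3)
      (fun i => by have := hx i.succ; omega) (by omega) (fun i => hxy i.succ)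
    obtain ⟨p₄, h₄⟩ := ihg (Fin.cons (b + 1) (Fin.cons y fun i => x i.succ)) (b + 2) (b + 3)
      (fun i => by
        refine Fin.cases (by simp) (fun i => Fin.cases ?_ (fun i => ?_) i) i
        · simp; omega
        · have := hx i.succ
          simp; omega)
      (by omega)
      (fun i => by
        refine Fin.cases (by simp) (fun i => Fin.cases ?_ (fun i => ?_) i) i
        · simp; omega
        · have := hx i.succ
          simp; omega)
    obtain ⟨p₅, h₅⟩ := exists_assigns_copy (b := b + 3) (x := b + 2) (y := y)
      (by omega) (by omega) (by omega)
    refine ⟨(p₁.seq ((loop (b + 1) skip).seq p₃)).seq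
      (loop b (p₄.seq (p₅.seq (inc (b + 1))))), fun s => ?_⟩
    obtain ⟨s₁, r₁, e₁, f₁⟩ := h₁ s
    obtain ⟨s₂, r₂, e₂, f₂⟩ := h₂ s₁
    obtain ⟨s₃, r₃, e₃, f₃⟩ := h₃ s₂
    set V := List.Vector.ofFn fun i : Fin n => s (x i.succ) with hV
    obtain ⟨s₄, r₄, e₄⟩ := exists_runs_loop (r := b) (p := p₄.seq (p₅.seq (inc (b + 1))))
      (fun k t => t b = k ∧ t (b + 1) + k = s (x 0) ∧
        t y = Nat.rec (f V) (fun y IH => g (y ::ᵥ IH ::ᵥ V)) (t (b + 1)) ∧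
        ∀ r < b, r ≠ y → t r = s r)
      (fun n s h => h.1)
      (fun k t ⟨i1, i2, i3, i4⟩ => by
        obtain ⟨t₁, q₁, c₁, d₁⟩ := h₄ (Function.update t b k)
        obtain ⟨t₂, q₂, c₂, d₂⟩ := h₅ t₁
        refine ⟨_, q₁.seq (q₂.seq (runs_inc _ _)), ?_⟩
        have hb : t₂ b = k := by
          rw [d₂ b (by omega) (by omega), d₁ b (by omega) (by omega), Function.update_self]
        have hb1 : t₂ (b + 1) = t (b + 1) := by
          rw [d₂ _ (by omega) (by omega), d₁ _ (by omega) (by omega),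
            Function.update_of_ne (by omega)]
        have hr : ∀ r < b, r ≠ y → t₂ r = s r := fun r hr hry => by
          rw [d₂ r (by omega) hry, d₁ r (by omega) (by omega),
            Function.update_of_ne (by omega), i4 r hr hry]
        refine ⟨?_, ?_, ?_, fun r hr' hry => ?_⟩
        · rw [Function.update_of_ne (by omega), hb]
        · rw [Function.update_self, hb1]; omega
        · rw [Function.update_of_ne (by omega), Function.update_self, c₂]
          beta_reduce
          rw [c₁, hb1]
          beta_reduce
          have hu : ∀ i : Fin n, Function.update t b k (x i.succ) = s (x i.succ) := fun i => by
            rw [Function.update_of_ne (by have := hx i.succ; omega), i4 _ (hx _) (hxy _)]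
          have : (List.Vector.ofFn fun i => Function.update t b k
              ((Fin.cons (b + 1) (Fin.cons y fun i => x i.succ) : Fin (n + 2) → ℕ) i)) =
              t (b + 1) ::ᵥ t y ::ᵥ V := by
            simp only [List.Vector.ofFn, Fin.cons_zero, Fin.cons_succ, hu, hV]
            rw [Function.update_of_ne (by omega), Function.update_of_ne (by omega)]
          rw [this, i3]
        · rw [Function.update_of_ne (by omega), hr r hr' hry])
      (s (x 0)) s₃
      (by
        have hs : ∀ r < b, s₂ r = s r := fun r hr => by
          rw [f₂ r (by omega) (by omega), f₁ r (by omega) (by omega)]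
        have h1 : s₃ (b + 1) = 0 := by rw [f₃ _ (by omega) (by omega), e₂]
        refine ⟨?_, ?_, ?_, fun r hr hry => ?_⟩
        · rw [f₃ _ (by omega) (by omega), f₂ _ (by omega) (by omega), e₁]
        · rw [h1, zero_add]
        · rw [h1, e₃]
          simp only [hs _ (hx _), hV]
          rfl
        · rw [f₃ r (by omega) hry, hs r hr])
    obtain ⟨-, i2, i3, i4⟩ := e₄
    refine ⟨s₄, (r₁.seq (r₂.seq r₃)).seq r₄, ?_, i4⟩
    rw [i3, show s₄ (b + 1) = s (x 0) by omega]
    simp [List.Vector.ofFn, hV]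

/-! ### Unbounded search and an undecidable halting problem -/

/-- The machine stops on the configuration `c`. -/
def Halts (c : List Prog × (ℕ → ℕ)) : Prop := ∃ n, ((step machine)^[n] c).1 = []

theorem iterate_step_nil {c : List Prog × (ℕ → ℕ)} (hc : c.1 = []) (n : ℕ) :
    (step machine)^[n] c = c := by
  have : Function.IsFixedPt (step machine) c := by
    unfold Function.IsFixedPt step
    rw [hc]
    rfl
  exact this.iterate n

theorem Runs.halts_iff {p : Prog} {s s' : ℕ → ℕ} (h : Runs p s s') {K : List Prog} :
    Halts (p :: K, s) ↔ Halts (K, s') := by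
  obtain ⟨n, hn⟩ := h K
  constructor
  · rintro ⟨m, hm⟩
    refine ⟨m, ?_⟩
    rw [← hn, ← Function.iterate_add_apply, add_comm, Function.iterate_add_apply,
      iterate_step_nil hm, hm]
  · rintro ⟨m, hm⟩
    exact ⟨m + n, by rw [Function.iterate_add_apply, hn, hm]⟩

/-- The store with the value `m` in register `0` and zero elsewhere. -/
def input (m : ℕ) : ℕ → ℕ := Function.update (fun _ => 0) 0 m

/-- Unbounded search with a register machine. -/
theorem exists_halts_iff {g : ℕ → ℕ → ℕ} (hg : Primrec₂ g) :
    ∃ p, ∀ m, Halts ([p], input m) ↔ ∃ k, g m k = 0 := by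
  obtain ⟨p, hp⟩ := exists_assigns_of_primrec (Nat.Primrec'.prim_iff₂.2 hg)
    (fun i => i.1) 2 3 (fun i => by omega) (by omega) (fun i => by omega)
  have hp' : ∀ m k s, s 0 = m → s 1 = k → ∃ s', Runs p s s' ∧ s' 0 = m ∧ s' 1 = k ∧
      s' 2 = g m k := fun m k s h0 h1 => by
    obtain ⟨s', r, e, f⟩ := hp s
    refine ⟨s', r, by rw [f 0 (by omega) (by omega), h0], by rw [f 1 (by omega) (by omega), h1], ?_⟩
    rw [e, ← h0, ← h1]
    rfl
  -- Registers `0`, `1`, `2` hold the input, the candidate `k` and the value `g m k`. The loop on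
  -- register `2` stops at a zero; its decrement is harmless, as `p` overwrites that register.
  let q := (inc 1).seq p
  have hq : ∀ m k s, s 0 = m → s 1 = k → s 2 ≠ 0 → ∃ s',
      Runs q (Function.update s 2 (s 2 - 1)) s' ∧ s' 0 = m ∧ s' 1 = k + 1 ∧
      s' 2 = g m (k + 1) := fun m k s h0 h1 h2 => by
    obtain ⟨s', r, e⟩ := hp' m (k + 1) (Function.update (Function.update s 2 (s 2 - 1)) 1
      (Function.update s 2 (s 2 - 1) 1 + 1)) (by simp [h0]) (by simp [h1])
    exact ⟨s', (runs_inc _ _).seq r, e⟩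
  have loop_halts : ∀ m d k s, s 0 = m → s 1 = k → s 2 = g m k → g m (k + d) = 0 →
      Halts ([loop 2 q], s) := by
    intro m d
    induction d with
    | zero =>
      intro k s h0 h1 h2 h3
      rw [(runs_loop_zero q (h2.trans h3)).halts_iff]
      exact ⟨0, rfl⟩
    | succ d ih =>
      intro k s h0 h1 h2 h3
      by_cases h : s 2 = 0
      · rw [(runs_loop_zero q h).halts_iff]
        exact ⟨0, rfl⟩
      · obtain ⟨s', r, e0, e1, e2⟩ := hq m k s h0 h1 h
        obtain ⟨n, hn⟩ := r.halts_iff.2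
          (ih (k + 1) s' e0 e1 e2 (by rw [← h3]; congr 1; omega))
        refine ⟨n + 1, ?_⟩
        rwa [Function.iterate_succ_apply, step_loop_of_ne_zero q [] h]
  -- Every pass takes at least one step and returns to the loop, so a halting time would yield a
  -- smaller one.
  have of_loop_halts : ∀ m, (∀ k, g m k ≠ 0) → ∀ N k s, s 0 = m → s 1 = k → s 2 = g m k →
      ((step machine)^[N] ([loop 2 q], s)).1 ≠ [] := by
    intro m hm N
    induction N using Nat.strong_induction_on with
    | _ N ih =>
      intro k s h0 h1 h2 hN
      have h : s 2 ≠ 0 := by rw [h2]; exact hm k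
      obtain ⟨s', r, e0, e1, e2⟩ := hq m k s h0 h1 h
      obtain ⟨n, hn⟩ := r [loop 2 q]
      have hn' : (step machine)^[n + 1] ([loop 2 q], s) = ([loop 2 q], s') := by
        rw [Function.iterate_succ_apply, step_loop_of_ne_zero q [] h, hn]
      rcases Nat.lt_or_ge N (n + 1) with hlt | hge
      · have := iterate_step_nil hN (n + 1 - N)
        rw [← Function.iterate_add_apply, Nat.sub_add_cancel hlt.le, hn'] at this
        rw [← this] at hN
        simp at hN
      · refine ih (N - (n + 1)) (by omega) (k + 1) s' e0 e1 e2 ?_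
        rwa [← hn', ← Function.iterate_add_apply, Nat.sub_add_cancel hge]
  refine ⟨p.seq (loop 2 q), fun m => ?_⟩
  obtain ⟨s, r, e0, e1, e2⟩ := hp' m 0 (input m) rfl rfl
  have hred : Halts ([p.seq (loop 2 q)], input m) ↔ Halts ([loop 2 q], s) := by
    rw [← r.halts_iff]
    constructor
    · rintro ⟨n, hn⟩
      refine ⟨n, ?_⟩
      have : step machine ([p.seq (loop 2 q)], input m) = ([p, loop 2 q], input m) := rfl
      rw [← this, ← Function.iterate_succ_apply, Function.iterate_succ_apply']
      have h2 := iterate_step_nil hn 1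
      rw [Function.iterate_one] at h2
      rw [h2, hn]
    · rintro ⟨n, hn⟩
      exact ⟨n + 1, hn⟩
  rw [hred]
  constructor
  · rintro ⟨N, hN⟩
    by_contra hne
    exact of_loop_halts m (fun k hk => hne ⟨k, hk⟩) N 0 s e0 e1 e2 hN
  · rintro ⟨k, hk⟩
    exact loop_halts m k 0 s e0 e1 e2 (by rwa [zero_add])

/-- There is a program with an undecidable halting problem. -/
theorem exists_not_computablePred_halts :
    ∃ p, ¬ ComputablePred fun m => Halts ([p], input m) := by
  let g : ℕ → ℕ → ℕ := fun m k =>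
    bif ((Denumerable.ofNat Nat.Partrec.Code m).evaln k 0).isSome then 0 else 1
  have hg : Primrec₂ g := by
    refine Primrec.cond (Primrec.option_isSome.comp (Nat.Partrec.Code.primrec_evaln.comp
      (Primrec.pair (Primrec.pair Primrec.snd ((Primrec.ofNat _).comp Primrec.fst))
        (Primrec.const 0)))) (Primrec.const 0) (Primrec.const 1)
  obtain ⟨p, hp⟩ := exists_halts_iff hg
  refine ⟨p, fun h => ComputablePred.halting_problem 0 ?_⟩
  refine ComputablePred.of_eq (ComputablePred.computable_of_manyOneReducible
    (p := fun c : Nat.Partrec.Code => Halts ([p], input (Encodable.encode c)))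
    ⟨_, Computable.encode, fun c => Iff.rfl⟩ h) fun c => ?_
  rw [hp]
  simp only [g, Denumerable.ofNat_encode, Part.dom_iff_mem]
  have : ∀ k, (bif (c.evaln k 0).isSome then 0 else 1) = 0 ↔ ∃ x, x ∈ c.evaln k 0 := fun k => by
    cases h : c.evaln k 0 <;> simp
  simp only [this, Nat.Partrec.Code.evaln_complete]
  exact exists_comm

/-- The states that occur in the execution of `p` before `K` is reached. -/
def states : Prog → List Prog → List (List Prog)
  | skip, K => [skip :: K]
  | inc r, K => [inc r :: K]
  | loop r p, K => (loop r p :: K) :: states p (loop r p :: K)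
  | seq p q, K => (seq p q :: K) :: (states p (q :: K) ++ states q K)

end Prog

/-- The states that follow an instruction. -/
def Instr.targets {Q : Type*} : Instr Q → List Q
  | halt => []
  | goto q => [q]
  | inc _ q => [q]
  | branch _ q₀ q₁ => [q₀, q₁]

namespace Prog

theorem cons_mem_states (p : Prog) (K : List Prog) : p :: K ∈ p.states K := by
  cases p <;> simp [states]

/-- The machine has infinitely many states, but one program meets only finitely many. This makes
`law` a finite conjunction. -/
theorem targets_states (p : Prog) (K : List Prog) : ∀ a ∈ p.states K,
    ∀ a' ∈ (machine a).targets, a' ∈ p.states K ∨ a' = K := by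
  induction p generalizing K with
  | skip => simp [states, machine, Instr.targets]
  | inc r => simp [states, machine, Instr.targets]
  | loop r p ih =>
    intro a ha a' ha'
    rcases List.mem_cons.1 ha with rfl | ha
    · simp only [machine, Instr.targets, List.mem_cons, List.not_mem_nil, or_false] at ha'
      rcases ha' with rfl | rfl
      · exact .inr rfl
      · exact .inl (List.mem_cons_of_mem _ (cons_mem_states _ _))
    · rcases ih _ a ha a' ha' with h | rfl
      · exact .inl (List.mem_cons_of_mem _ h)
      · exact .inl List.mem_cons_self
  | seq p q ihp ihq =>
    intro a ha a' ha'
    simp only [states, List.mem_cons, List.mem_append] at ha ⊢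
    rcases ha with rfl | ha | ha
    · simp only [machine, Instr.targets, List.mem_cons, List.not_mem_nil, or_false] at ha'
      rw [ha']
      exact .inl (.inr (.inl (cons_mem_states _ _)))
    · rcases ihp _ a ha a' ha' with h | rfl
      · exact .inl (.inr (.inl h))
      · exact .inl (.inr (.inr (cons_mem_states _ _)))
    · rcases ihq _ a ha a' ha' with h | rfl
      · exact .inl (.inr (.inr h))
      · exact .inr rfl

end Prog

end FOLTL

namespace FOLTL

/-! ### Models without explicit domains -/

/-- Truth in a constant domain model whose domain is the whole type `X`. -/
def Tr {P T X : Type*} [LinearOrder T] (I : T → P → X → Prop) : T → X → Formula P → Prop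
  | t, a, .pred p => I t p a
  | t, a, .neg φ => ¬ Tr I t a φ
  | t, a, .and φ ψ => Tr I t a φ ∧ Tr I t a ψ
  | t, a, .diamF φ => ∃ t' : T, t < t' ∧ Tr I t' a φ
  | t, a, .exNe φ => ∃ b : X, b ≠ a ∧ Tr I t b φ

/-- Any two moments are comparable, so all domains coincide and the common domain can serve as the
type of objects. -/
theorem constantDomainSatisfiable_iff_tr {P : Type u} (φ : Formula P) :
    ConstantDomainSatisfiable.{u, v, w} φ ↔ ∃ (T : Type v) (_ : LinearOrder T) (X : Type w)
      (I : T → P → X → Prop) (t : T) (a : X), Tr I t a φ := by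
  constructor
  · rintro ⟨T, _, M, hM, t₀, a₀, ha₀, hφ⟩
    have hdom : ∀ t, M.dom t = M.dom t₀ := fun t => by
      rcases lt_trichotomy t t₀ with h | rfl | h
      exacts [hM _ _ h, rfl, (hM _ _ h).symm]
    let I : T → P → M.dom t₀ → Prop := fun t p a => a.1 ∈ M.interp t p
    have key : ∀ (ψ : Formula P) t (a : M.dom t₀), Tr I t a ψ ↔ M.Holds t a ψ := by
      intro ψ
      induction ψ with
      | pred p => exact fun t a => Iff.rfl
      | neg ψ ih => exact fun t a => not_congr (ih t a)
      | and ψ χ ih1 ih2 => exact fun t a => and_congr (ih1 t a) (ih2 t a)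
      | diamF ψ ih =>
        refine fun t a => exists_congr fun s => and_congr_right fun _ => ?_
        have ha : a.1 ∈ M.dom s := by rw [hdom]; exact a.2
        rw [ih]
        exact (and_iff_right ha).symm
      | exNe ψ ih =>
        refine fun t a => ⟨?_, ?_⟩
        · rintro ⟨b, hb, h⟩
          exact ⟨b, by rw [hdom]; exact b.2, fun he => hb (Subtype.ext he), (ih t b).1 h⟩
        · rintro ⟨b, hb, hne, h⟩
          rw [hdom] at hb
          exact ⟨⟨b, hb⟩, fun he => hne (congrArg Subtype.val he), (ih t ⟨b, hb⟩).2 h⟩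
    exact ⟨T, inferInstance, M.dom t₀, I, t₀, ⟨a₀, ha₀⟩, (key φ _ _).2 hφ⟩
  · rintro ⟨T, _, X, I, t, a, h⟩
    let M : Model.{u, v, w} P T :=
      { U := X
        dom := fun _ => Set.univ
        dom_nonempty := fun _ => ⟨a, trivial⟩
        interp := fun t p => {a | I t p a}
        interp_subset := fun _ _ => Set.subset_univ _ }
    have key : ∀ (ψ : Formula P) t (a : X), Tr I t a ψ ↔ M.Holds t a ψ := by
      intro ψ
      induction ψ with
      | pred p => exact fun t a => Iff.rfl
      | neg ψ ih => exact fun t a => not_congr (ih t a)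
      | and ψ χ ih1 ih2 => exact fun t a => and_congr (ih1 t a) (ih2 t a)
      | diamF ψ ih =>
        refine fun t a => exists_congr fun s => and_congr_right fun _ => ?_
        rw [ih]
        exact (and_iff_right trivial).symm
      | exNe ψ ih =>
        refine fun t a => exists_congr fun b => ?_
        rw [ih]
        exact (and_iff_right trivial).symm
    exact ⟨T, inferInstance, M, fun _ _ _ => rfl, t, a, trivial, (key φ _ _).1 h⟩

namespace Formula

variable {P : Type*}

/-- Implication. -/
def imp (φ ψ : Formula P) : Formula P := neg (and φ (neg ψ))

/-- Disjunction. -/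
def or (φ ψ : Formula P) : Formula P := imp (neg φ) ψ

/-- "Always in the future". -/
def boxF (φ : Formula P) : Formula P := neg (diamF (neg φ))

/-- "For some `x`". -/
def ex (φ : Formula P) : Formula P := or φ (exNe φ)

/-- "For all `x`, now and always in the future". -/
def always (φ : Formula P) : Formula P :=
  and (neg (ex (neg φ))) (boxF (neg (ex (neg φ))))

/-- The conjunction of `φ` and the formulas in a list. -/
def conj (φ : Formula P) (l : List (Formula P)) : Formula P := l.foldr and φ

end Formula

section Tr

variable {P T X : Type*} [LinearOrder T] (I : T → P → X → Prop) (t : T) (a : X)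
  (φ ψ : Formula P)

@[simp] theorem tr_pred (p : P) : Tr I t a (.pred p) ↔ I t p a := Iff.rfl

@[simp] theorem tr_neg : Tr I t a φ.neg ↔ ¬ Tr I t a φ := Iff.rfl

@[simp] theorem tr_and : Tr I t a (φ.and ψ) ↔ Tr I t a φ ∧ Tr I t a ψ := Iff.rfl

@[simp] theorem tr_diamF : Tr I t a φ.diamF ↔ ∃ t', t < t' ∧ Tr I t' a φ := Iff.rfl

@[simp] theorem tr_exNe : Tr I t a φ.exNe ↔ ∃ b, b ≠ a ∧ Tr I t b φ := Iff.rfl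

@[simp] theorem tr_imp : Tr I t a (φ.imp ψ) ↔ (Tr I t a φ → Tr I t a ψ) := by
  simp [Formula.imp]

@[simp] theorem tr_or : Tr I t a (φ.or ψ) ↔ Tr I t a φ ∨ Tr I t a ψ := by
  simp [Formula.or, or_iff_not_imp_left]

@[simp] theorem tr_boxF : Tr I t a φ.boxF ↔ ∀ t', t < t' → Tr I t' a φ := by
  simp [Formula.boxF]

@[simp] theorem tr_ex : Tr I t a φ.ex ↔ ∃ b, Tr I t b φ := by
  simp only [Formula.ex, tr_or, tr_exNe]
  constructor
  · rintro (h | ⟨b, -, h⟩)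
    exacts [⟨a, h⟩, ⟨b, h⟩]
  · rintro ⟨b, h⟩
    by_cases hb : b = a
    · exact .inl (hb ▸ h)
    · exact .inr ⟨b, hb, h⟩

@[simp] theorem tr_always : Tr I t a φ.always ↔ ∀ t', t ≤ t' → ∀ b, Tr I t' b φ := by
  simp only [Formula.always, tr_and, tr_neg, tr_ex, tr_boxF, not_exists, not_not]
  constructor
  · rintro ⟨h1, h2⟩ t' ht b
    rcases ht.eq_or_lt with rfl | ht
    exacts [h1 b, h2 t' ht b]
  · exact fun h => ⟨h t le_rfl, fun t' ht => h t' ht.le⟩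

@[simp] theorem tr_conj (l : List (Formula P)) :
    Tr I t a (φ.conj l) ↔ Tr I t a φ ∧ ∀ ψ ∈ l, Tr I t a ψ := by
  induction l with
  | nil => simp [Formula.conj]
  | cons χ l ih =>
    rw [Formula.conj, List.foldr_cons, tr_and, List.forall_mem_cons]
    rw [Formula.conj] at ih
    rw [ih]
    tauto

end Tr

/-! ### The formulas that describe the run of a register machine -/

/-- The predicate symbols that are used to describe the run of a register machine. The contents of
a register are represented by the number of objects that have been inserted into the register and
not deleted from it. -/
inductive Sym (Q : Type*)
  /-- the object of the present step of the run -/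
  | ev : Sym Q
  /-- the input is being loaded -/
  | load : Sym Q
  /-- the present state is `q` -/
  | st (q : Q) : Sym Q
  /-- the object is now inserted into the register `r` -/
  | ent (r : ℕ) : Sym Q
  /-- the object has been inserted into the register `r` -/
  | ins (r : ℕ) : Sym Q
  /-- the object is now deleted from the register `r` -/
  | del (r : ℕ) : Sym Q
  /-- the object has been deleted from the register `r` -/
  | out (r : ℕ) : Sym Q
  deriving Countable

namespace Formula

variable {P Q : Type*} (ν : Sym Q → P)

/-- "At the next step, `φ` holds for the object of that step." -/
def nextStep (φ : Formula P) : Formula P :=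
  -- The object of the next event names it: the future moments before that event are those at which
  -- `ev` still lies ahead for this object, and they must carry no event.
  ex (and (diamF (and (pred (ν .ev)) φ))
    (boxF (imp (diamF (pred (ν .ev))) (neg (ex (pred (ν .ev)))))))

/-- The present step inserts its object into the registers in `ρ` only, and deletes an object from
the registers in `δ` only. -/
def effect (R : List ℕ) (ρ δ : Option ℕ) : Formula P :=
  conj (pred (ν .ev)) (R.map fun r =>
    and (if ρ = some r then pred (ν (.ent r)) else neg (pred (ν (.ent r))))
      (if δ = some r then ex (pred (ν (.del r))) else neg (ex (pred (ν (.del r))))))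

/-- The execution of an instruction. -/
def execute (R : List ℕ) : Instr Q → Formula P
  -- This contradicts the event at which it is imposed, so a halting run has no model.
  | .halt => neg (pred (ν .ev))
  | .goto q => and (effect ν R none none) (nextStep ν (pred (ν (.st q))))
  | .inc r q => and (effect ν R (some r) none) (nextStep ν (pred (ν (.st q))))
  | .branch r q₀ q₁ =>
    or (and (neg (ex (and (pred (ν (.ins r))) (neg (pred (ν (.out r)))))))
        (and (effect ν R none none) (nextStep ν (pred (ν (.st q₀))))))
      -- No test for a nonzero register is required, since `registerLaw` lets only live objects be
      -- deleted.
      (and (effect ν R none (some r)) (nextStep ν (pred (ν (.st q₁)))))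

/-- The behaviour of the register `r`. -/
def registerLaw (r : ℕ) : Formula P :=
  conj (imp (pred (ν (.ins r))) (boxF (pred (ν (.ins r)))))
    [imp (pred (ν (.out r))) (and (pred (ν (.ins r))) (boxF (pred (ν (.out r))))),
     imp (pred (ν (.ent r)))
      (and (pred (ν .ev)) (and (neg (pred (ν (.ins r)))) (boxF (pred (ν (.ins r)))))),
     imp (pred (ν (.del r)))
      (conj (ex (pred (ν .ev))) [pred (ν (.ins r)), neg (pred (ν (.out r))),
        boxF (pred (ν (.out r))), neg (exNe (pred (ν (.del r))))]),
     -- This clause and the next exclude changes without a cause, which a dense order would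
     -- otherwise permit between events.
     imp (and (neg (pred (ν (.ins r)))) (diamF (pred (ν (.ins r)))))
      (or (pred (ν (.ent r))) (diamF (pred (ν (.ent r))))),
     imp (and (neg (pred (ν (.out r)))) (diamF (pred (ν (.out r)))))
      (or (pred (ν (.del r))) (diamF (pred (ν (.del r)))))]

/-- All laws of the run of the machine `M` with states in `S` and registers in `R`. -/
def law (M : Q → Instr Q) (S : List Q) (R : List ℕ) : Formula P :=
  conj (imp (pred (ν .ev)) (and (neg (exNe (pred (ν .ev)))) (boxF (neg (pred (ν .ev))))))
    (imp (and (pred (ν .ev)) (pred (ν .load))) (effect ν R (some 0) none) ::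
      (R.map (registerLaw ν) ++
        S.map fun q => imp (and (pred (ν .ev)) (pred (ν (.st q)))) (execute ν R (M q))))

/-- The part of the description of the run that does not depend on the input. -/
def runLaw (M : Q → Instr Q) (S : List Q) (R : List ℕ) : Formula P :=
  and (always (law ν M S R))
    (conj (pred (ν .ev)) (R.map fun r => neg (ex (pred (ν (.ins r))))))

/-- The initial part of the run, in which the number `n` is loaded into the register `0`. -/
def loadInput (q : Q) : ℕ → Formula P
  | 0 => and (pred (ν .ev)) (pred (ν (.st q)))
  | n + 1 => and (and (pred (ν .ev)) (pred (ν .load))) (nextStep ν (loadInput q n))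

/-- The description of the run of the machine `M` on the input `n`. -/
def runFormula (M : Q → Instr Q) (S : List Q) (R : List ℕ) (q : Q) (n : ℕ) : Formula P :=
  and (runLaw ν M S R) (loadInput ν q n)

end Formula

/-! ### The meaning of these formulas -/

section Semantics

open Formula (nextStep effect execute registerLaw law runLaw)

variable {Q T X : Type*} [LinearOrder T] (J : T → Sym Q → X → Prop)

/-- The meaning of `nextStep`. -/
def NextStep (t : T) (ψ : T → X → Prop) : Prop :=
  ∃ b, (∃ t', t < t' ∧ J t' .ev b ∧ ψ t' b) ∧
    ∀ s, t < s → (∃ u, s < u ∧ J u .ev b) → ¬ ∃ y, J s .ev y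

/-- The meaning of `effect`. -/
def Effect (R : List ℕ) (ρ δ : Option ℕ) (t : T) (x : X) : Prop :=
  J t .ev x ∧ ∀ r ∈ R, (J t (.ent r) x ↔ ρ = some r) ∧ ((∃ y, J t (.del r) y) ↔ δ = some r)

/-- The meaning of `execute`. -/
def Execute (R : List ℕ) (t : T) (x : X) : Instr Q → Prop
  | .halt => ¬ J t .ev x
  | .goto q => Effect J R none none t x ∧ NextStep J t fun t' y => J t' (.st q) y
  | .inc r q => Effect J R (some r) none t x ∧ NextStep J t fun t' y => J t' (.st q) y
  | .branch r q₀ q₁ =>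
    ((¬ ∃ y, J t (.ins r) y ∧ ¬ J t (.out r) y) ∧ Effect J R none none t x ∧
      NextStep J t fun t' y => J t' (.st q₀) y) ∨
    (Effect J R none (some r) t x ∧ NextStep J t fun t' y => J t' (.st q₁) y)

/-- The meaning of `registerLaw`. -/
structure RegisterLaw (r : ℕ) (t : T) (x : X) : Prop where
  ins_mono : J t (.ins r) x → ∀ t', t < t' → J t' (.ins r) x
  out_mono : J t (.out r) x → J t (.ins r) x ∧ ∀ t', t < t' → J t' (.out r) x
  ent : J t (.ent r) x → J t .ev x ∧ ¬ J t (.ins r) x ∧ ∀ t', t < t' → J t' (.ins r) x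
  del : J t (.del r) x → (∃ y, J t .ev y) ∧ J t (.ins r) x ∧ ¬ J t (.out r) x ∧
    (∀ t', t < t' → J t' (.out r) x) ∧ ¬ ∃ y, y ≠ x ∧ J t (.del r) y
  ins_new : (¬ J t (.ins r) x ∧ ∃ t', t < t' ∧ J t' (.ins r) x) →
    J t (.ent r) x ∨ ∃ t', t < t' ∧ J t' (.ent r) x
  out_new : (¬ J t (.out r) x ∧ ∃ t', t < t' ∧ J t' (.out r) x) →
    J t (.del r) x ∨ ∃ t', t < t' ∧ J t' (.del r) x

/-- The meaning of `law`. -/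
structure Law (M : Q → Instr Q) (S : List Q) (R : List ℕ) (t : T) (x : X) : Prop where
  ev : J t .ev x → (¬ ∃ y, y ≠ x ∧ J t .ev y) ∧ ∀ t', t < t' → ¬ J t' .ev x
  load : J t .ev x ∧ J t .load x → Effect J R (some 0) none t x
  register : ∀ r ∈ R, RegisterLaw J r t x
  state : ∀ q ∈ S, J t .ev x ∧ J t (.st q) x → Execute J R t x (M q)

variable {P : Type*} (ν : Sym Q → P) (I : T → P → X → Prop) (t : T) (x : X)

theorem tr_nextStep (φ : Formula P) : Tr I t x (nextStep ν φ) ↔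
    NextStep (fun t s x => I t (ν s) x) t fun t' y => Tr I t' y φ := by
  simp only [nextStep, tr_ex, tr_and, tr_diamF, tr_boxF, tr_imp, tr_neg, tr_pred, NextStep]

theorem tr_effect (R : List ℕ) (ρ δ : Option ℕ) : Tr I t x (effect ν R ρ δ) ↔
    Effect (fun t s x => I t (ν s) x) R ρ δ t x := by
  simp only [effect, tr_conj, tr_pred, List.forall_mem_map, tr_and, Effect]
  refine and_congr_right fun _ => forall₂_congr fun r _ => and_congr ?_ ?_
  · split_ifs with h <;> simp [h]
  · split_ifs with h <;> simp [h]

theorem tr_execute (R : List ℕ) (i : Instr Q) : Tr I t x (execute ν R i) ↔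
    Execute (fun t s x => I t (ν s) x) R t x i := by
  cases i <;> simp only [execute, Execute, tr_and, tr_or, tr_neg, tr_ex, tr_effect, tr_nextStep,
    tr_pred]

theorem tr_registerLaw (r : ℕ) : Tr I t x (registerLaw ν r) ↔
    RegisterLaw (fun t s x => I t (ν s) x) r t x := by
  simp only [registerLaw, tr_conj, tr_imp, tr_and, tr_or, tr_boxF, tr_diamF, tr_ex, tr_exNe,
    tr_neg, tr_pred, List.forall_mem_cons, List.not_mem_nil, false_imp_iff, implies_true, and_true]
  exact ⟨fun ⟨h1, h2, h3, h4, h5, h6⟩ => ⟨h1, h2, h3, h4, h5, h6⟩,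
    fun ⟨h1, h2, h3, h4, h5, h6⟩ => ⟨h1, h2, h3, h4, h5, h6⟩⟩

theorem tr_law (M : Q → Instr Q) (S : List Q) (R : List ℕ) : Tr I t x (law ν M S R) ↔
    Law (fun t s x => I t (ν s) x) M S R t x := by
  simp only [law, tr_conj, tr_imp, tr_and, tr_exNe, tr_boxF, tr_neg, tr_pred,
    List.forall_mem_cons, List.forall_mem_append, List.forall_mem_map, tr_effect, tr_execute,
    tr_registerLaw]
  exact ⟨fun ⟨h1, h2, h3, h4⟩ => ⟨h1, h2, h3, h4⟩, fun ⟨h1, h2, h3, h4⟩ => ⟨h1, h2, h3, h4⟩⟩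

theorem tr_runLaw (M : Q → Instr Q) (S : List Q) (R : List ℕ) : Tr I t x (runLaw ν M S R) ↔
    (∀ t', t ≤ t' → ∀ y, Law (fun t s x => I t (ν s) x) M S R t' y) ∧
      I t (ν .ev) x ∧ ∀ r ∈ R, ¬ ∃ y, I t (ν (.ins r)) y := by
  simp only [runLaw, tr_and, tr_always, tr_law, tr_conj, tr_pred, List.forall_mem_map, tr_neg,
    tr_ex]

end Semantics

end FOLTL

namespace FOLTL

/-! ### A model of the description of a run yields the run -/

section RunOfModel

variable {Q T X : Type*} [LinearOrder T] {J : T → Sym Q → X → Prop} {M : Q → Instr Q}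
  {S : List Q} {R : List ℕ} {t₀ t t' : T}

/-- The objects that represent the contents of the register `r` at the moment `t`. -/
def live (J : T → Sym Q → X → Prop) (r : ℕ) (t : T) : Set X :=
  {y | J t (.ins r) y ∧ ¬ J t (.out r) y}

/-- The registers in `R` contain the numbers given by `s`. -/
def Counts (J : T → Sym Q → X → Prop) (R : List ℕ) (t : T) (s : ℕ → ℕ) : Prop :=
  ∀ r ∈ R, (live J r t).encard = s r

/-- A property gained by `t'` is caused by `ent` or `del` at some `s ≥ t`. Such an `s` carries an
event and the property does not hold there yet, which by monotonicity and the absence of events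
between leaves only `s = t`. So the entered objects join the live ones and the deleted ones leave;
both sets have at most one element. -/
theorem encard_live_next (hlaw : ∀ t, t₀ ≤ t → ∀ y, Law J M S R t y) (ht₀ : t₀ ≤ t) (ht : t < t')
    (hbetween : ∀ s, t < s → s < t' → ∀ y, ¬ J s .ev y) {ρ δ : Option ℕ} {x : X}
    (heff : Effect J R ρ δ t x) {r : ℕ} (hr : r ∈ R) :
    (live J r t').encard + (if δ = some r then 1 else 0) =
      (live J r t).encard + (if ρ = some r then 1 else 0) := by
  have hR : ∀ s, t₀ ≤ s → ∀ y, RegisterLaw J r s y := fun s hs y => (hlaw s hs y).register r hr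
  have hins : ∀ y, J t' (.ins r) y ↔ J t (.ins r) y ∨ J t (.ent r) y := by
    intro y
    constructor
    · intro h
      by_contra! hn
      obtain h' | ⟨s, hs, h'⟩ := (hR t ht₀ y).ins_new ⟨hn.1, t', ht, h⟩
      · exact hn.2 h'
      · obtain ⟨h1, h2, -⟩ := (hR s (ht₀.trans hs.le) y).ent h'
        rcases lt_trichotomy s t' with hlt | rfl | hlt
        · exact hbetween s hs hlt y h1
        · exact h2 h
        · exact h2 ((hR t' (ht₀.trans ht.le) y).ins_mono h s hlt)
    · rintro (h | h)
      · exact (hR t ht₀ y).ins_mono h t' ht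
      · exact ((hR t ht₀ y).ent h).2.2 t' ht
  have hout : ∀ y, J t' (.out r) y ↔ J t (.out r) y ∨ J t (.del r) y := by
    intro y
    constructor
    · intro h
      by_contra! hn
      obtain h' | ⟨s, hs, h'⟩ := (hR t ht₀ y).out_new ⟨hn.1, t', ht, h⟩
      · exact hn.2 h'
      · obtain ⟨⟨z, h1⟩, -, h2, -⟩ := (hR s (ht₀.trans hs.le) y).del h'
        rcases lt_trichotomy s t' with hlt | rfl | hlt
        · exact hbetween s hs hlt z h1
        · exact h2 h
        · exact h2 (((hR t' (ht₀.trans ht.le) y).out_mono h).2 s hlt)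
    · rintro (h | h)
      · exact ((hR t ht₀ y).out_mono h).2 t' ht
      · exact ((hR t ht₀ y).del h).2.2.2.1 t' ht
  obtain ⟨hev, heff⟩ := heff
  obtain ⟨hent, hdel⟩ := heff r hr
  have hA : {y | J t (.ent r) y}.encard = if ρ = some r then 1 else 0 := by
    split_ifs with h
    · rw [Set.encard_eq_one]
      refine ⟨x, Set.eq_singleton_iff_unique_mem.2 ⟨hent.2 h, fun y hy => ?_⟩⟩
      by_contra hne
      exact ((hlaw t ht₀ x).ev hev).1 ⟨y, hne, ((hR t ht₀ y).ent hy).1⟩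
    · rw [Set.encard_eq_zero, Set.eq_empty_iff_forall_notMem]
      intro y hy
      have hyx : y = x := by
        by_contra hne
        exact ((hlaw t ht₀ x).ev hev).1 ⟨y, hne, ((hR t ht₀ y).ent hy).1⟩
      exact h (hent.1 (hyx ▸ hy))
  have hD : {y | J t (.del r) y}.encard = if δ = some r then 1 else 0 := by
    split_ifs with h
    · obtain ⟨y, hy⟩ := hdel.2 h
      rw [Set.encard_eq_one]
      refine ⟨y, Set.eq_singleton_iff_unique_mem.2 ⟨hy, fun z hz => ?_⟩⟩
      by_contra hne
      exact ((hR t ht₀ y).del hy).2.2.2.2 ⟨z, hne, hz⟩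
    · rw [Set.encard_eq_zero, Set.eq_empty_iff_forall_notMem]
      exact fun y hy => h (hdel.1 ⟨y, hy⟩)
  have hlive : live J r t' = (live J r t ∪ {y | J t (.ent r) y}) \ {y | J t (.del r) y} := by
    ext y
    simp only [live, Set.mem_ofPred_eq, Set.mem_sdiff, Set.mem_union, hins, hout]
    have h1 : J t (.ent r) y → ¬ J t (.ins r) y := fun h => ((hR t ht₀ y).ent h).2.1
    have h2 : J t (.out r) y → J t (.ins r) y := fun h => ((hR t ht₀ y).out_mono h).1
    tauto
  rw [← hA, ← hD, hlive, Set.encard_sdiff_add_encard_of_subset, Set.encard_union_eq]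
  · rw [Set.disjoint_left]
    exact fun y h1 h2 => ((hR t ht₀ y).ent h2).2.1 h1.1
  · exact fun y hy => .inl ⟨((hR t ht₀ y).del hy).2.1, ((hR t ht₀ y).del hy).2.2.1⟩

theorem Counts.next (hlaw : ∀ t, t₀ ≤ t → ∀ y, Law J M S R t y) (ht₀ : t₀ ≤ t)
    {ψ : T → X → Prop} (hψ : NextStep J t ψ) {ρ δ : Option ℕ} {x : X}
    (heff : Effect J R ρ δ t x) {s s' : ℕ → ℕ} (hs : Counts J R t s)
    (hs' : ∀ r ∈ R, s' r + (if δ = some r then 1 else 0) = s r + (if ρ = some r then 1 else 0)) :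
    ∃ t' y, t₀ ≤ t' ∧ J t' .ev y ∧ ψ t' y ∧ Counts J R t' s' := by
  obtain ⟨y, ⟨t', ht, hev, hψ⟩, hnext⟩ := hψ
  refine ⟨t', y, ht₀.trans ht.le, hev, hψ, fun r hr => ?_⟩
  have h := encard_live_next hlaw ht₀ ht
    (fun s h1 h2 z hz => hnext s h1 ⟨t', h2, hev⟩ ⟨z, hz⟩) heff hr
  have h' : ((s' r + (if δ = some r then 1 else 0) : ℕ) : ℕ∞) =
    ((s r + (if ρ = some r then 1 else 0) : ℕ) : ℕ∞) := congrArg _ (hs' r hr)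
  push_cast at h'
  rw [hs r hr, ← h'] at h
  refine (ENat.add_left_injective_of_ne_top ?_) h
  split_ifs <;> simp

/-- The state at the moment `t` is `q`, and the registers in `R` contain the numbers given
by `s`. -/
def Represents (J : T → Sym Q → X → Prop) (R : List ℕ) (t₀ : T) (c : Q × (ℕ → ℕ)) : Prop :=
  ∃ t x, t₀ ≤ t ∧ J t .ev x ∧ J t (.st c.1) x ∧ Counts J R t c.2

/-- Only registers that are branched on must lie in `R`: the others never influence the run, and
`Counts` ignores them. -/
theorem Represents.step (hlaw : ∀ t, t₀ ≤ t → ∀ y, Law J M S R t y)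
    (hR : ∀ q ∈ S, ∀ r q₀ q₁, M q = .branch r q₀ q₁ → r ∈ R) {c : Q × (ℕ → ℕ)} (hc : c.1 ∈ S)
    (h : Represents J R t₀ c) : M c.1 ≠ .halt ∧ Represents J R t₀ (step M c) := by
  obtain ⟨t, x, ht₀, hev, hst, hcount⟩ := h
  have hex := (hlaw t ht₀ x).state c.1 hc ⟨hev, hst⟩
  unfold FOLTL.step
  cases hM : M c.1 with
  | halt =>
    rw [hM] at hex
    exact (hex hev).elim
  | goto q =>
    rw [hM] at hex
    exact ⟨nofun, hcount.next hlaw ht₀ hex.2 hex.1 (by simp)⟩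
  | inc r q =>
    rw [hM] at hex
    refine ⟨nofun, hcount.next hlaw ht₀ hex.2 hex.1 fun k _ => ?_⟩
    by_cases hk : k = r
    · subst hk; simp
    · simp [hk, Ne.symm hk]
  | branch r q₀ q₁ =>
    rw [hM] at hex
    refine ⟨nofun, ?_⟩
    have hr := hR c.1 hc r q₀ q₁ hM
    rcases hex with ⟨h1, h2, h3⟩ | ⟨h2, h3⟩
    · have h0 : c.2 r = 0 := by
        have : live J r t = ∅ := Set.eq_empty_iff_forall_notMem.2 fun y hy => h1 ⟨y, hy⟩
        have h := hcount r hr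
        rw [this, Set.encard_empty] at h
        exact_mod_cast h.symm
      simp only [h0, if_true]
      exact hcount.next hlaw ht₀ h3 h2 (by simp)
    · have h0 : c.2 r ≠ 0 := fun h0 => by
        obtain ⟨y, hy⟩ := (h2.2 r hr).2.2 rfl
        have h := hcount r hr
        rw [h0, Nat.cast_zero, Set.encard_eq_zero] at h
        have hy' := ((hlaw t ht₀ y).register r hr).del hy
        exact Set.notMem_empty y (h ▸ (⟨hy'.2.1, hy'.2.2.1⟩ : y ∈ live J r t))
      simp only [h0, if_false]
      refine hcount.next hlaw ht₀ h3 h2 fun k _ => ?_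
      by_cases hk : k = r
      · subst hk; simp; omega
      · simp [hk, Ne.symm hk]

theorem step_mem {c : Q × (ℕ → ℕ)} (hS : ∀ q ∈ S, ∀ q' ∈ (M q).targets, q' ∈ S) (hc : c.1 ∈ S) :
    (step M c).1 ∈ S := by
  have h := hS c.1 hc
  unfold step
  cases hM : M c.1 with
  | halt => exact hc
  | goto q => exact h q (by simp [hM, Instr.targets])
  | inc r q => exact h q (by simp [hM, Instr.targets])
  | branch r q₀ q₁ =>
    dsimp only
    split_ifs
    · exact h q₀ (by simp [hM, Instr.targets])
    · exact h q₁ (by simp [hM, Instr.targets])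

variable {P : Type*} {ν : Sym Q → P} {I : T → P → X → Prop}

theorem represents_of_tr_loadInput
    (hlaw : ∀ t, t₀ ≤ t → ∀ y, Law (fun t s x => I t (ν s) x) M S R t y) {q : Q} (n : ℕ) :
    ∀ (t : T) (x : X) (s : ℕ → ℕ), t₀ ≤ t → Counts (fun t s x => I t (ν s) x) R t s →
      Tr I t x (Formula.loadInput ν q n) →
      Represents (fun t s x => I t (ν s) x) R t₀ (q, Function.update s 0 (s 0 + n)) := by
  induction n with
  | zero =>
    intro t x s ht₀ hs h
    exact ⟨t, x, ht₀, h.1, h.2, by simpa using hs⟩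
  | succ n ih =>
    intro t x s ht₀ hs h
    obtain ⟨⟨h1, h2⟩, h3⟩ := h
    have heff := (hlaw t ht₀ x).load ⟨h1, h2⟩
    obtain ⟨t', y, ht', -, htr, hs'⟩ := hs.next (s' := Function.update s 0 (s 0 + 1)) hlaw ht₀
      ((tr_nextStep ν I t x _).1 h3) heff fun k _ => by
        by_cases hk : k = 0
        · subst hk; simp
        · simp [hk, Ne.symm hk]
    have := ih t' y _ ht' hs' htr
    rwa [Function.update_idem, Function.update_self, Nat.add_assoc, Nat.add_comm 1 n] at this

theorem not_halt_of_tr_runFormula (hS : ∀ q ∈ S, ∀ q' ∈ (M q).targets, q' ∈ S)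
    (hR : ∀ q ∈ S, ∀ r q₀ q₁, M q = .branch r q₀ q₁ → r ∈ R) {q : Q} (hq : q ∈ S) {n : ℕ} {x : X}
    (h : Tr I t x (Formula.runFormula ν M S R q n)) (k : ℕ) :
    M ((step M)^[k] (q, Prog.input n)).1 ≠ .halt := by
  obtain ⟨hrun, hload⟩ := h
  obtain ⟨hlaw, hev, hins⟩ := (tr_runLaw ν I t x M S R).1 hrun
  have hcount : Counts (fun t s x => I t (ν s) x) R t fun _ => 0 := fun r hr => by
    rw [Nat.cast_zero, Set.encard_eq_zero, Set.eq_empty_iff_forall_notMem]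
    exact fun y hy => hins r hr ⟨y, hy.1⟩
  have h0 := represents_of_tr_loadInput hlaw n t x _ le_rfl hcount hload
  rw [Nat.zero_add] at h0
  have key : ((step M)^[k] (q, Prog.input n)).1 ∈ S ∧
      Represents (fun t s x => I t (ν s) x) R t ((step M)^[k] (q, Prog.input n)) := by
    induction k with
    | zero => exact ⟨hq, h0⟩
    | succ k ih =>
      rw [Function.iterate_succ_apply']
      exact ⟨step_mem hS ih.1, (ih.2.step hlaw hR ih.1).2⟩
  exact (key.2.step hlaw hR key.1).1

end RunOfModel

/-! ### An infinite run yields a model of its description -/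

/-- The machine does not stop on the instruction `i` and executes it with the store `s`, leading to
the next state `σ'`, where `ρ` is the register that is incremented and `δ` is the register that is
decremented. -/
def Instr.Executes {Q : Type*} (s : ℕ → ℕ) (ρ δ : Option ℕ) (σ' : Option Q) : Instr Q → Prop
  | .halt => False
  | .goto q => ρ = none ∧ δ = none ∧ σ' = some q
  | .inc r q => ρ = some r ∧ δ = none ∧ σ' = some q
  | .branch r q₀ q₁ => ρ = none ∧
    (s r = 0 ∧ δ = none ∧ σ' = some q₀ ∨ δ = some r ∧ σ' = some q₁)

/-- An infinite run, with states `σ` (`none` while the input is being loaded), stores `s`, registers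
`ρ` that are incremented and registers `δ` that are decremented. -/
structure IsRun {Q : Type*} (M : Q → Instr Q) (σ : ℕ → Option Q) (s : ℕ → ℕ → ℕ)
    (ρ δ : ℕ → Option ℕ) : Prop where
  zero r : s 0 r = 0
  succ i r : s (i + 1) r + (if δ i = some r then 1 else 0) =
    s i r + (if ρ i = some r then 1 else 0)
  pos i r : δ i = some r → s i r ≠ 0
  load i : σ i = none → ρ i = some 0 ∧ δ i = none
  state i q : σ i = some q → (M q).Executes (s i) (ρ i) (δ i) (σ (i + 1))

/-- This locates the insertion or deletion with a given number, counted from zero. -/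
theorem exists_lt_count_eq {p : ℕ → Prop} [DecidablePred p] {k n : ℕ} (h : k < Nat.count p n) :
    ∃ i < n, p i ∧ Nat.count p i = k := by
  induction n with
  | zero => simp at h
  | succ n ih =>
    rw [Nat.count_succ] at h
    by_cases hk : k < Nat.count p n
    · obtain ⟨i, hi, h'⟩ := ih hk
      exact ⟨i, by omega, h'⟩
    · split_ifs at h with hp
      · exact ⟨n, by omega, hp, by omega⟩
      · omega

/-- The number of moments before `t` at which `ρ` has the value `r`. -/
def uses (ρ : ℕ → Option ℕ) (r t : ℕ) : ℕ := Nat.count (fun i => ρ i = some r) t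

theorem uses_mono (ρ : ℕ → Option ℕ) (r : ℕ) : Monotone (uses ρ r) := Nat.count_monotone _

theorem uses_succ (ρ : ℕ → Option ℕ) (r t : ℕ) :
    uses ρ r (t + 1) = uses ρ r t + if ρ t = some r then 1 else 0 := Nat.count_succ _ _

theorem uses_lt {ρ : ℕ → Option ℕ} {r x t : ℕ} (hx : ρ x = some r) (h : x < t) :
    uses ρ r x < uses ρ r t := Nat.count_strict_mono (p := fun i => ρ i = some r) hx h

/-- The interpretation of the predicate symbols that is given by a run. The first object that was
inserted into a register is the first to be deleted. -/
def runInterp {Q : Type*} (σ : ℕ → Option Q) (ρ δ : ℕ → Option ℕ) (t : ℕ) (y : Sym Q) (x : ℕ) :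
    Prop :=
  match y with
  | .ev => x = t
  | .load => σ t = none
  | .st q => σ t = some q
  | .ent r => x = t ∧ ρ t = some r
  | .ins r => x < t ∧ ρ x = some r
  | .del r => δ t = some r ∧ (x < t ∧ ρ x = some r) ∧ uses ρ r x = uses δ r t
  | .out r => (x < t ∧ ρ x = some r) ∧ uses ρ r x < uses δ r t

namespace IsRun

variable {Q : Type*} {M : Q → Instr Q} {σ : ℕ → Option Q} {s : ℕ → ℕ → ℕ} {ρ δ : ℕ → Option ℕ}

theorem uses_eq (h : IsRun M σ s ρ δ) (r t : ℕ) : uses ρ r t = uses δ r t + s t r := by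
  induction t with
  | zero => simp [uses, h.zero]
  | succ t ih =>
    have := h.succ t r
    rw [uses_succ, uses_succ]
    omega

/-- The queue matches equally numbered insertions and deletions. Distinct insertions have distinct
numbers, so the deleted object is unique. -/
theorem registerLaw (h : IsRun M σ s ρ δ) (r t x : ℕ) :
    RegisterLaw (runInterp σ ρ δ) r t x where
  ins_mono hx t' ht := ⟨hx.1.trans ht, hx.2⟩
  out_mono hx := ⟨hx.1, fun t' ht =>
    ⟨⟨hx.1.1.trans ht, hx.1.2⟩, hx.2.trans_le (uses_mono δ r ht.le)⟩⟩
  ent hx := ⟨hx.1, fun h' => h'.1.ne hx.1, fun t' ht => ⟨hx.1 ▸ ht, hx.1 ▸ hx.2⟩⟩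
  del hx := by
    obtain ⟨h1, h2, h3⟩ := hx
    refine ⟨⟨t, rfl⟩, h2, fun h' => h'.2.ne h3, fun t' ht => ⟨⟨h2.1.trans ht, h2.2⟩, ?_⟩, ?_⟩
    · rw [h3]; exact uses_lt h1 ht
    · rintro ⟨y, hne, -, hy, hy'⟩
      exact hne (Nat.count_injective (p := fun i => ρ i = some r) hy.2 h2.2 (hy'.trans h3.symm))
  ins_new hx := by
    obtain ⟨h1, t', ht, h2⟩ := hx
    have hx : t ≤ x := not_lt.1 fun hlt => h1 ⟨hlt, h2.2⟩
    rcases hx.eq_or_lt with rfl | hlt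
    · exact .inl ⟨rfl, h2.2⟩
    · exact .inr ⟨x, hlt, rfl, h2.2⟩
  out_new hx := by
    obtain ⟨h1, t', ht, h2, h3⟩ := hx
    obtain ⟨i, hi, hδ, hi'⟩ := exists_lt_count_eq h3
    have hi' : uses δ r i = uses ρ r x := hi'
    -- If `i ≤ x`, at most `uses δ r i` insertions precede `i`. The register would then be empty at
    -- its deletion.
    have hxi : x < i := by
      by_contra! hle
      have h4 := uses_mono ρ r hle
      have h5 := h.uses_eq r i
      have h6 := h.pos i r hδ
      omega
    have hdel : runInterp σ ρ δ i (.del r) x := ⟨hδ, ⟨hxi, h2.2⟩, hi'.symm⟩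
    have hti : t ≤ i := by
      by_contra! hlt
      exact h1 ⟨⟨hxi.trans hlt, h2.2⟩, by rw [← hi']; exact uses_lt hδ hlt⟩
    rcases hti.eq_or_lt with rfl | hlt
    · exact .inl hdel
    · exact .inr ⟨i, hlt, hdel⟩

/-- A nonzero register has seen more insertions than deletions, so the insertion numbered `uses δ r
t` supplies the object to delete. -/
theorem effect (h : IsRun M σ s ρ δ) (R : List ℕ) (t : ℕ) :
    Effect (runInterp σ ρ δ) R (ρ t) (δ t) t t := by
  refine ⟨rfl, fun r _ => ⟨and_iff_right rfl, fun ⟨y, hy⟩ => hy.1, fun hδ => ?_⟩⟩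
  have h1 := h.uses_eq r t
  have h2 := h.pos t r hδ
  obtain ⟨i, hi, hρ, hi'⟩ := exists_lt_count_eq (p := fun i => ρ i = some r) (n := t)
    (k := uses δ r t) (by change _ < uses ρ r t; omega)
  exact ⟨i, hδ, ⟨hi, hρ⟩, hi'⟩

theorem nextStep (t : ℕ) {ψ : ℕ → ℕ → Prop} (hψ : ψ (t + 1) (t + 1)) :
    NextStep (runInterp σ ρ δ) t ψ := by
  refine ⟨t + 1, ⟨t + 1, Nat.lt_succ_self t, rfl, hψ⟩, fun i hi ⟨j, hj, hev⟩ => ?_⟩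
  have hev : t + 1 = j := hev
  omega

theorem law (h : IsRun M σ s ρ δ) (S : List Q) (R : List ℕ) (t x : ℕ) :
    Law (runInterp σ ρ δ) M S R t x where
  ev hx := ⟨fun ⟨y, hne, hy⟩ => hne (hy.trans hx.symm), fun t' ht hx' => ht.ne (hx.symm.trans hx')⟩
  load hx := by
    obtain ⟨rfl, hx⟩ := hx
    have := h.effect R x
    rwa [(h.load x hx).1, (h.load x hx).2] at this
  register r _ := h.registerLaw r t x
  state q _ hx := by
    obtain ⟨rfl, hx⟩ := hx
    have heff := h.effect R x
    have hex := h.state x q hx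
    cases hM : M q with
    | halt => rw [hM] at hex; exact hex.elim
    | goto q' =>
      rw [hM] at hex
      obtain ⟨h1, h2, h3⟩ := hex
      rw [h1, h2] at heff
      exact ⟨heff, nextStep x h3⟩
    | inc r q' =>
      rw [hM] at hex
      obtain ⟨h1, h2, h3⟩ := hex
      rw [h1, h2] at heff
      exact ⟨heff, nextStep x h3⟩
    | branch r q₀ q₁ =>
      rw [hM] at hex
      obtain ⟨h1, ⟨h0, h2, h3⟩ | ⟨h2, h3⟩⟩ := hex
      · rw [h1, h2] at heff
        refine .inl ⟨fun ⟨y, hy, hy'⟩ => hy' ⟨hy, ?_⟩, heff, nextStep x h3⟩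
        have h4 := uses_lt hy.2 hy.1
        have h5 := h.uses_eq r x
        omega
      · rw [h1, h2] at heff
        exact .inr ⟨heff, nextStep x h3⟩

variable {P : Type*} {ν : Sym Q → P} {I : ℕ → P → ℕ → Prop}

/-- The induction goes backwards in time: at moment `n - k`, `k` units remain to be loaded. -/
theorem tr_loadInput (hI : ∀ t y x, I t (ν y) x ↔ runInterp σ ρ δ t y x) {q : Q} {n : ℕ}
    (hload : ∀ i < n, σ i = none) (hn : σ n = some q) (k : ℕ) (hk : k ≤ n) :
    Tr I (n - k) (n - k) (Formula.loadInput ν q k) := by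
  induction k with
  | zero => exact ⟨(hI _ _ _).2 rfl, (hI _ _ _).2 hn⟩
  | succ k ih =>
    refine ⟨⟨(hI _ _ _).2 rfl, (hI _ _ _).2 (hload _ (by omega))⟩, ?_⟩
    rw [tr_nextStep]
    have : (fun t y x => I t (ν y) x) = runInterp σ ρ δ := by
      funext t y x; exact propext (hI t y x)
    rw [this]
    refine nextStep _ ?_
    rw [show n - (k + 1) + 1 = n - k by omega]
    exact ih (by omega)

theorem tr_runFormula (h : IsRun M σ s ρ δ) (hI : ∀ t y x, I t (ν y) x ↔ runInterp σ ρ δ t y x)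
    {q : Q} {n : ℕ} (hload : ∀ i < n, σ i = none) (hn : σ n = some q) (S : List Q) (R : List ℕ) :
    Tr I 0 0 (Formula.runFormula ν M S R q n) := by
  have hJ : (fun t y x => I t (ν y) x) = runInterp σ ρ δ := by
    funext t y x; exact propext (hI t y x)
  refine ⟨(tr_runLaw ν I 0 0 M S R).2 ⟨?_, (hI _ _ _).2 rfl, ?_⟩, ?_⟩
  · rw [hJ]
    exact fun t _ x => h.law S R t x
  · rintro r - ⟨y, hy⟩
    exact Nat.not_lt_zero _ ((hI _ _ _).1 hy).1
  · have := tr_loadInput hI hload hn n le_rfl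
    rwa [Nat.sub_self] at this

end IsRun

/-- The run of a machine that does not stop. -/
theorem exists_isRun {Q : Type*} (M : Q → Instr Q) (q : Q) (n : ℕ)
    (h : ∀ k, M ((step M)^[k] (q, Prog.input n)).1 ≠ .halt) :
    ∃ σ s ρ δ, IsRun M σ s ρ δ ∧ (∀ i < n, σ i = none) ∧ σ n = some q := by
  let c : ℕ → Q × (ℕ → ℕ) := fun k => (step M)^[k] (q, Prog.input n)
  have hc : ∀ k, c (k + 1) = step M (c k) := fun k => Function.iterate_succ_apply' _ _ _
  -- Moments below `n` load the input; moment `i ≥ n` shows the configuration after `i - n` steps.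
  let σ : ℕ → Option Q := fun i => if i < n then none else some (c (i - n)).1
  let s : ℕ → ℕ → ℕ := fun i => if i < n then Prog.input i else (c (i - n)).2
  let ρ : ℕ → Option ℕ := fun i => if i < n then some 0 else
    match M (c (i - n)).1 with
    | .inc r _ => some r
    | _ => none
  let δ : ℕ → Option ℕ := fun i => if i < n then none else
    match M (c (i - n)).1 with
    | .branch r _ _ => if (c (i - n)).2 r = 0 then none else some r
    | _ => none
  have hs : ∀ i ≤ n, s i = Prog.input i := fun i hi => by
    rcases hi.eq_or_lt with rfl | hlt
    · simp [s, c]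
    · simp [s, hlt]
  refine ⟨σ, s, ρ, δ, ⟨fun r => ?_, fun i r => ?_, fun i r hδ => ?_, fun i hσ => ?_,
    fun i q' hσ => ?_⟩, fun i hi => by simp [σ, hi], by simp [σ, c]⟩
  · rw [hs 0 (Nat.zero_le n)]
    simp [Prog.input]
  · by_cases hi : i < n
    · rw [hs i hi.le, hs (i + 1) hi]
      simp only [ρ, δ, hi, if_true, Prog.input]
      by_cases hr : r = 0
      · subst hr; simp
      · simp [hr, Ne.symm hr]
    · have hi' : ¬ i + 1 < n := by omega
      simp only [s, ρ, δ, hi, hi', if_false, Nat.sub_add_comm (not_lt.1 hi), hc, step]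
      cases hM : M (c (i - n)).1 with
      | halt => simp
      | goto q' => simp
      | inc r' q' =>
        by_cases hr : r = r'
        · subst hr; simp
        · simp [hr, Ne.symm hr]
      | branch r' q₀ q₁ =>
        by_cases h0 : (c (i - n)).2 r' = 0
        · simp [h0]
        · by_cases hr : r = r'
          · subst hr; simp [h0]; omega
          · simp [h0, hr, Ne.symm hr]
  · by_cases hi : i < n
    · simp [δ, hi] at hδ
    · simp only [δ, s, hi, if_false] at hδ ⊢
      cases hM : M (c (i - n)).1 with
      | branch r' q₀ q₁ =>
        simp only [hM] at hδ
        split_ifs at hδ with h0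
        obtain rfl := Option.some_injective _ hδ
        exact h0
      | _ => simp [hM] at hδ
  · have hi : i < n := by
      by_contra hi
      simp [σ, hi] at hσ
    simp [ρ, δ, hi]
  · have hi : ¬ i < n := fun hi => by simp [σ, hi] at hσ
    have hi' : ¬ i + 1 < n := by omega
    have hq : (c (i - n)).1 = q' := by simpa [σ, hi] using hσ
    have hne := h (i - n)
    change M (c (i - n)).1 ≠ .halt at hne
    simp only [σ, s, ρ, δ, hi, hi', if_false, Nat.sub_add_comm (not_lt.1 hi), hc, step]
    rw [hq] at hne ⊢
    cases hM : M q' with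
    | halt => exact hne hM
    | goto q'' => simp [Instr.Executes]
    | inc r q'' => simp [Instr.Executes]
    | branch r q₀ q₁ =>
      by_cases h0 : (c (i - n)).2 r = 0
      · simp [Instr.Executes, h0]
      · simp [Instr.Executes, h0]

/-! ### Undecidability -/

theorem tr_uLift {P T X : Type*} [LinearOrder T] (I : T → P → X → Prop) (φ : Formula P) :
    ∀ (t : ULift.{v} T) (a : ULift.{w} X),
      Tr (fun (t : ULift.{v} T) p (a : ULift.{w} X) => I t.down p a.down) t a φ ↔
        Tr I t.down a.down φ := by
  induction φ with
  | pred p => exact fun t a => Iff.rfl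
  | neg ψ ih => exact fun t a => not_congr (ih t a)
  | and ψ χ ih1 ih2 => exact fun t a => and_congr (ih1 t a) (ih2 t a)
  | diamF ψ ih =>
    refine fun t a => ⟨fun ⟨s, hs, h⟩ => ⟨s.down, hs, (ih s a).1 h⟩,
      fun ⟨s, hs, h⟩ => ⟨⟨s⟩, hs, (ih ⟨s⟩ a).2 h⟩⟩
  | exNe ψ ih =>
    refine fun t a => ⟨fun ⟨b, hb, h⟩ => ⟨b.down, fun he => hb (ULift.ext _ _ he), (ih t b).1 h⟩,
      fun ⟨b, hb, h⟩ => ⟨⟨b⟩, fun he => hb (congrArg ULift.down he), (ih t ⟨b⟩).2 h⟩⟩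

theorem constantDomainSatisfiable_runFormula_iff {P : Type u} {Q : Type*} {ν : Sym Q → P}
    (hν : Function.Injective ν) (M : Q → Instr Q) (S : List Q) (R : List ℕ)
    (hS : ∀ q ∈ S, ∀ q' ∈ (M q).targets, q' ∈ S)
    (hR : ∀ q ∈ S, ∀ r q₀ q₁, M q = .branch r q₀ q₁ → r ∈ R) {q : Q} (hq : q ∈ S) (n : ℕ) :
    ConstantDomainSatisfiable.{u, v, w} (Formula.runFormula ν M S R q n) ↔
      ∀ k, M ((step M)^[k] (q, Prog.input n)).1 ≠ .halt := by
  rw [constantDomainSatisfiable_iff_tr]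
  constructor
  · rintro ⟨T, _, X, I, t, a, h⟩
    exact not_halt_of_tr_runFormula hS hR hq h
  · intro h
    obtain ⟨σ, s, ρ, δ, hrun, hload, hn⟩ := exists_isRun M q n h
    let I : ℕ → P → ℕ → Prop := fun t p x => ∃ y, ν y = p ∧ runInterp σ ρ δ t y x
    have hI : ∀ t y x, I t (ν y) x ↔ runInterp σ ρ δ t y x := fun t y x =>
      ⟨fun ⟨z, hz, h⟩ => hν hz ▸ h, fun h => ⟨y, rfl, h⟩⟩
    exact ⟨ULift.{v} ℕ, inferInstance, ULift.{w} ℕ, fun t p a => I t.down p a.down, ⟨0⟩, ⟨0⟩,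
      (tr_uLift I _ _ _).2 (hrun.tr_runFormula hI hload hn S R)⟩

/-- The laws are a constant, and `loadInput` is a primitive recursion whose step acts arithmetically
on codes. -/
theorem primrec_runFormula {P : Type u} [Denumerable P] {Q : Type*} (ν : Sym Q → P)
    (M : Q → Instr Q) (S : List Q) (R : List ℕ) (q : Q) :
    Primrec (Formula.runFormula ν M S R q) := by
  have hand : Primrec₂ (Formula.and : Formula P → Formula P → Formula P) := by
    refine Primrec₂.encode_iff.1 ?_
    change Primrec₂ fun φ ψ : Formula P =>
      5 * Nat.pair (Encodable.encode φ) (Encodable.encode ψ) + 2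
    exact Primrec.nat_add.comp (Primrec.nat_mul.comp (Primrec.const 5) (Primrec₂.natPair.comp
      (Primrec.encode.comp Primrec.fst) (Primrec.encode.comp Primrec.snd))) (Primrec.const 2)
  have hneg : Primrec (Formula.neg : Formula P → Formula P) := by
    refine Primrec.encode_iff.1 ?_
    change Primrec fun φ : Formula P => 5 * Encodable.encode φ + 1
    exact Primrec.nat_add.comp (Primrec.nat_mul.comp (Primrec.const 5) Primrec.encode)
      (Primrec.const 1)
  have hdiamF : Primrec (Formula.diamF : Formula P → Formula P) := by
    refine Primrec.encode_iff.1 ?_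
    change Primrec fun φ : Formula P => 5 * Encodable.encode φ + 3
    exact Primrec.nat_add.comp (Primrec.nat_mul.comp (Primrec.const 5) Primrec.encode)
      (Primrec.const 3)
  have hexNe : Primrec (Formula.exNe : Formula P → Formula P) := by
    refine Primrec.encode_iff.1 ?_
    change Primrec fun φ : Formula P => 5 * Encodable.encode φ + 4
    exact Primrec.nat_add.comp (Primrec.nat_mul.comp (Primrec.const 5) Primrec.encode)
      (Primrec.const 4)
  have hex : Primrec (Formula.ex : Formula P → Formula P) :=
    hneg.comp (hand.comp hneg (hneg.comp hexNe))
  have hnext : Primrec (Formula.nextStep ν) :=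
    hex.comp (hand.comp (hdiamF.comp (hand.comp (Primrec.const _) Primrec.id)) (Primrec.const _))
  have hload : Primrec (Formula.loadInput ν q) := by
    refine (Primrec.nat_rec₁ (f := fun _ φ => Formula.and (Formula.and (Formula.pred (ν .ev))
      (Formula.pred (ν .load))) (Formula.nextStep ν φ))
      (Formula.and (Formula.pred (ν .ev)) (Formula.pred (ν (.st q))))
      (hand.comp (Primrec.const _) (hnext.comp Primrec.snd))).of_eq fun n => ?_
    induction n with
    | zero => rfl
    | succ n ih =>
      simp only at ih ⊢
      rw [ih]
      rfl
  exact hand.comp (Primrec.const _) hload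

theorem not_computablePred_constantDomainSatisfiable (P : Type u) [Denumerable P] :
    ¬ ComputablePred fun φ : Formula P => ConstantDomainSatisfiable.{u, v, w} φ := by
  obtain ⟨p, hp⟩ := Prog.exists_not_computablePred_halts
  -- The injection need not be computable, as only finitely many of its values occur in the
  -- formulas.
  obtain ⟨ν, hν⟩ : ∃ ν : Sym (List Prog) → P, Function.Injective ν := by
    obtain ⟨f, hf⟩ := exists_injective_nat (Sym (List Prog))
    exact ⟨_, (Denumerable.eqv P).symm.injective.comp hf⟩
  -- `states` omits the final continuation, here the halting state `[]`; adding it closes `S` under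
  -- targets.
  let S : List (List Prog) := [] :: p.states []
  let R : List ℕ := S.flatMap fun q => match Prog.machine q with
    | .branch r _ _ => [r]
    | _ => []
  have hS : ∀ q ∈ S, ∀ q' ∈ (Prog.machine q).targets, q' ∈ S := by
    intro q hq q' hq'
    rcases List.mem_cons.1 hq with rfl | hq
    · simp [Prog.machine, Instr.targets] at hq'
    · rcases p.targets_states [] q hq q' hq' with h | rfl
      exacts [List.mem_cons_of_mem _ h, List.mem_cons_self]
  have hR : ∀ q ∈ S, ∀ r q₀ q₁, Prog.machine q = .branch r q₀ q₁ → r ∈ R := by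
    intro q hq r q₀ q₁ hM
    exact List.mem_flatMap.2 ⟨q, hq, by rw [hM]; exact List.mem_singleton_self r⟩
  have hq : [p] ∈ S := List.mem_cons_of_mem _ (p.cons_mem_states [])
  have hhalt : ∀ q, Prog.machine q = .halt ↔ q = [] := by
    rintro (_ | ⟨_ | _ | _ | _, K⟩) <;> simp [Prog.machine]
  intro h
  have h' := ComputablePred.computable_of_manyOneReducible
    (p := fun n => ConstantDomainSatisfiable.{u, v, w}
      (Formula.runFormula ν Prog.machine S R [p] n))
    ⟨_, (primrec_runFormula ν Prog.machine S R [p]).to_comp, fun n => Iff.rfl⟩ h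
  refine hp (h'.not.of_eq fun n => ?_)
  rw [constantDomainSatisfiable_runFormula_iff hν Prog.machine S R hS hR hq, Prog.Halts]
  push Not
  exact exists_congr fun k => hhalt _

end FOLTL

theorem mainTheorem12 (P : Type u) [Denumerable P] :
    ¬ ComputablePred (fun φ : FOLTL.Formula P => FOLTL.ConstantDomainSatisfiable.{u, v, w} φ) ∧
      REPred (fun φ : FOLTL.Formula P => ¬ FOLTL.ConstantDomainSatisfiable.{u, v, w} φ) :=
  ⟨FOLTL.not_computablePred_constantDomainSatisfiable P,
    FOLTL.rePred_not_constantDomainSatisfiable P⟩
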